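/- Let $k$ be an algebraically closed field of characteristic $0$. Let $\Delta\subset\mathbb R^2$ be a rational triangle (a nondegenerate triangle with vertices in $\mathbb Q^2$) with one horizontal edge, whose other two edges have rational slopes $s$ and $t$ with $0<s<t$. Let $X_\Delta=\operatorname{Proj}\bigoplus_{d\ge 0} k\langle \chi^m : m\in d\Delta\cap\mathbb Z^2\rangle$ be the projective toric surface over $k$ defined by $\Delta$ (the toric surface of the normal fan of $\Delta$). For positive integers $w_0,w_1,w_2$ let $\mathbb P(w_0,w_1,w_2)=\operatorname{Proj} k[x_0,x_1,x_2]$ with $\deg x_i=w_i$ be the weighted projective plane. Write $s=a/p$ and $t=b/q$ in lowest terms, with $a,p,b,q$ positive integers. Then $X_\Delta$ is isomorphic over $k$ to a weighted projective plane, that is, to $\mathbb P(w_0,w_1,w_2)$ for some positive integers $w_0,w_1,w_2$, if and only if $\gcd(a,b)=1$. In that case $bp-aq>0$ and $X_\Delta\cong\mathbb P(a,b,bp-aq)$ over $k$. -/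

import Mathlib

open AlgebraicGeometry CategoryTheory
open scoped Pointwise

universe u

namespace ToricTriangle

/-- A rational triangle in the plane: a nondegenerate triangle with vertices in `ℚ²`. -/
structure RationalTriangle where
  vertex : Fin 3 → ℚ × ℚ
  nondegenerate : AffineIndependent ℚ vertex

/-- The line through `P` and `Q` is not vertical and has slope `m`. -/
def HasSlope (P Q : ℚ × ℚ) (m : ℚ) : Prop :=
  P.1 ≠ Q.1 ∧ (Q.2 - P.2) / (Q.1 - P.1) = m

/-- The triangle as a closed region of `ℝ²`. -/
def RationalTriangle.region (Δ : RationalTriangle) : Set (ℝ × ℝ) :=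
  convexHull ℝ (Set.range fun i => (((Δ.vertex i).1 : ℝ), ((Δ.vertex i).2 : ℝ)))

theorem RationalTriangle.region_convex (Δ : RationalTriangle) : Convex ℝ Δ.region :=
  convex_convexHull ℝ _

theorem RationalTriangle.region_nonempty (Δ : RationalTriangle) : Δ.region.Nonempty :=
  (Set.range_nonempty _).convexHull

/-- The semigroup of pairs `(d, m)` with `d ∈ ℕ` and `m` a lattice point of the dilate `d • Δ`,
that is, the lattice points of the cone over `Δ × {1}`. -/
def RationalTriangle.semigroup (Δ : RationalTriangle) : AddSubmonoid (ℕ × (ℤ × ℤ)) where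
  carrier := {x | ((x.2.1 : ℝ), (x.2.2 : ℝ)) ∈ (x.1 : ℝ) • Δ.region}
  zero_mem' := by
    show (((0 : ℤ) : ℝ), ((0 : ℤ) : ℝ)) ∈ ((0 : ℕ) : ℝ) • Δ.region
    rw [Nat.cast_zero, Set.zero_smul_set Δ.region_nonempty, Int.cast_zero]
    exact Set.zero_mem_zero
  add_mem' := by
    rintro x y hx hy
    have h := Set.add_mem_add (show ((x.2.1 : ℝ), (x.2.2 : ℝ)) ∈ (x.1 : ℝ) • Δ.region from hx)
      (show ((y.2.1 : ℝ), (y.2.2 : ℝ)) ∈ (y.1 : ℝ) • Δ.region from hy)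
    rw [← Δ.region_convex.add_smul (Nat.cast_nonneg _) (Nat.cast_nonneg _)] at h
    simpa using h

/-- The degree `(d, m) ↦ d`. -/
def RationalTriangle.degree (Δ : RationalTriangle) : Δ.semigroup →+ ℕ :=
  (AddMonoidHom.fst ℕ (ℤ × ℤ)).comp Δ.semigroup.subtype

/-- `Proj` of an `ℕ`-graded `k`-algebra, as a scheme over `Spec k`. -/
noncomputable def projOver (k : Type u) [Field k] {A : Type u} [CommRing A] [Algebra k A]
    (𝒜 : ℕ → Submodule k A) [GradedAlgebra 𝒜] : Over (Spec (CommRingCat.of k)) :=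
  Over.mk (Proj.toSpecZero 𝒜 ≫ Spec.map (CommRingCat.ofHom (algebraMap k (𝒜 0))))

/-- The projective toric surface `X_Δ` over `k`: `Proj` of the graded algebra whose degree `d` part
has as basis the monomials `χᵐ`, `m` a lattice point of `d • Δ`. -/
noncomputable def toricSurface (k : Type u) [Field k] (Δ : RationalTriangle) :
    Over (Spec (CommRingCat.of k)) :=
  projOver k (AddMonoidAlgebra.gradeBy k Δ.degree)

/-- The weighted projective plane `ℙ(w₀, w₁, w₂)` over `k`: `Proj` of `k[x₀, x₁, x₂]` with
`deg xᵢ = wᵢ`. -/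
noncomputable def weightedProjectivePlane (k : Type u) [Field k] (w : Fin 3 → ℕ) :
    Over (Spec (CommRingCat.of k)) :=
  letI := MvPolynomial.weightedGradedAlgebra k w
  projOver k (MvPolynomial.weightedHomogeneousSubmodule k w)

end ToricTriangle

/-!
The two halves of the statement rest on two properties of `Proj`.

*Coprime slopes.* `Proj` of a graded algebra does not change, over `k`, when the algebra is replaced
by a Veronese subring (`IsVeronese.projOverIso`). If `N • Δ` has vertices in the lattice, the three
edges of `N • Δ` have primitive integral equations, which for `gcd(a, b) = 1` become three linear
forms `L₀, L₁, L₂` with `a L₀ + b L₁ + (bp - aq) L₂ = D d` for a positive integer `D`. They map the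
lattice points of `d • (N • Δ)` bijectively onto the monomials of weighted degree `D d` in three
variables; Bézout coefficients of `a` and `b` give the surjectivity (`nonempty_iso_of_coprime`).
So a Veronese subring of the algebra of `Δ` is also a Veronese subring of the weighted polynomial
ring.

*Slopes with a common factor.* The class group of a weighted projective plane is torsion free,
whereas that of `X_Δ` has torsion of order `g = gcd(a, b)`. To avoid divisors, the torsion is
detected by `PowersAreLocal g`, a property of a scheme expressed through its stalks alone: a
rational function which is a `g`-th power up to a unit at every point whose local ring is a
valuation ring is a `g`-th power. It holds for a weighted projective plane because the polynomial
ring is factorial and its units are `g`-th powers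
(`gradedPowersAreLocal_of_uniqueFactorizationMonoid`). On `X_Δ` it
fails for the monomial `χ^(1, 0)` when `g > 1`: a point whose local ring is a valuation ring is not
a torus fixed point, so it lies in the charts of two vertices (`exists_two_vertices_notMem`), where
the monomials along the edge joining them are units; and `(1, 0)` is congruent modulo `g` to a
multiple of the direction of each edge, `(1, 0)`, `(p, a)` or `(q, b)`, because `g` divides `a` and
`b` (`not_powersAreLocal_toricSurface`).
-/

namespace ToricTriangle

/-! ### Rational functions that are locally powers -/

/-- A ring in which divisibility is a total relation; for domains this means a valuation ring. -/
def DvdTotal (R : Type*) [CommRing R] : Prop := ∀ a b : R, a ∣ b ∨ b ∣ a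

theorem DvdTotal.of_ringEquiv {R S : Type*} [CommRing R] [CommRing S] (e : R ≃+* S)
    (h : DvdTotal R) : DvdTotal S := fun a b => by
  rcases h (e.symm a) (e.symm b) with h | h
  · exact Or.inl (by simpa using map_dvd e h)
  · exact Or.inr (by simpa using map_dvd e h)

/-- For a scheme with generic point `ξ`: a rational function `f` which, at every point whose local
ring is a valuation ring, is a unit times the `g`-th power of a rational function, is itself the
`g`-th power of a rational function. On a normal variety this says that no divisor class other than
zero is killed by `g`, and that global units are `g`-th powers. -/
def PowersAreLocal (g : ℕ) (X : Scheme.{u}) : Prop :=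
  ∀ (ξ : X) (hξ : ∀ x, ξ ⤳ x) (f : X.presheaf.stalk ξ),
    (∀ x, DvdTotal (X.presheaf.stalk x) →
      ∃ (u : X.presheaf.stalk x) (h : X.presheaf.stalk ξ),
        IsUnit u ∧ f = X.presheaf.stalkSpecializes (hξ x) u * h ^ g) →
    ∃ h, f = h ^ g

theorem PowersAreLocal.of_iso {g : ℕ} {X Y : Scheme.{u}} (e : X ≅ Y) (hX : PowersAreLocal g X) :
    PowersAreLocal g Y := by
  intro ξ hξ f hf
  obtain ⟨ξ, rfl⟩ : ∃ ξ', e.hom ξ' = ξ := ⟨e.inv ξ, by simp⟩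
  have hspec : ∀ x, ξ ⤳ x := fun x => by
    have := (hξ (e.hom x)).map e.inv.continuous
    simpa using this
  have := hX ξ hspec (e.hom.stalkMap ξ f) ?_
  · obtain ⟨h, hh⟩ := this
    let E := (asIso (e.hom.stalkMap ξ)).commRingCatIsoToRingEquiv
    refine ⟨E.symm h, E.injective ?_⟩
    rw [map_pow, RingEquiv.apply_symm_apply]
    exact hh
  · intro x hx
    let E := (asIso (e.hom.stalkMap x)).commRingCatIsoToRingEquiv
    obtain ⟨u, h, hu, hh⟩ := hf (e.hom x) (hx.of_ringEquiv E.symm)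
    refine ⟨e.hom.stalkMap x u, e.hom.stalkMap ξ h, hu.map (e.hom.stalkMap x).hom, ?_⟩
    rw [hh, map_mul, map_pow]
    congr 1
    exact Scheme.Hom.stalkSpecializes_stalkMap_apply e.hom ξ x (hspec x) u

section Graded

variable {A σ : Type*} [CommRing A] [SetLike σ A] [AddSubgroupClass σ A]
  (𝒜 : ℕ → σ) [GradedRing 𝒜]

/-- The homogeneous localization at a point of the projective spectrum. -/
abbrev LocalRingAt (x : ProjectiveSpectrum 𝒜) : Type _ :=
  HomogeneousLocalization.AtPrime 𝒜 x.asHomogeneousIdeal.toIdeal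

variable {𝒜} in
theorem primeCompl_le {ξ x : ProjectiveSpectrum 𝒜} (h : ξ ≤ x) :
    x.asHomogeneousIdeal.toIdeal.primeCompl ≤ ξ.asHomogeneousIdeal.toIdeal.primeCompl :=
  fun _ ha hb => ha (h hb)

/-- The property `PowersAreLocal g` of `Proj 𝒜`, in terms of the homogeneous localizations of the
graded ring. -/
def GradedPowersAreLocal (g : ℕ) : Prop :=
  ∀ (ξ : ProjectiveSpectrum 𝒜) (hξ : ∀ x, ξ ≤ x) (f : LocalRingAt 𝒜 ξ),
    (∀ x, DvdTotal (LocalRingAt 𝒜 x) →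
      ∃ (u : LocalRingAt 𝒜 x) (h : LocalRingAt 𝒜 ξ),
        IsUnit u ∧ f = HomogeneousLocalization.mapId 𝒜 (primeCompl_le (hξ x)) u * h ^ g) →
    ∃ h, f = h ^ g

variable {𝒜}

/-- The element `a / s` of the homogeneous localization at `x`, for homogeneous `a` and `s` of the
same degree with `s` outside the prime of `x`. -/
def fraction {x : ProjectiveSpectrum 𝒜} {d : ℕ} {a s : A} (ha : a ∈ 𝒜 d) (hs : s ∈ 𝒜 d)
    (hsx : s ∉ x.asHomogeneousIdeal) : LocalRingAt 𝒜 x :=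
  .mk ⟨d, ⟨a, ha⟩, ⟨s, hs⟩, hsx⟩

theorem exists_eq_fraction {x : ProjectiveSpectrum 𝒜} (f : LocalRingAt 𝒜 x) :
    ∃ (d : ℕ) (a s : A) (ha : a ∈ 𝒜 d) (hs : s ∈ 𝒜 d) (hsx : s ∉ x.asHomogeneousIdeal),
      f = fraction ha hs hsx := by
  obtain ⟨⟨d, ⟨a, ha⟩, ⟨s, hs⟩, hsx⟩, rfl⟩ := HomogeneousLocalization.mk_surjective f
  exact ⟨d, a, s, ha, hs, hsx, rfl⟩

theorem mul_notMem {x : ProjectiveSpectrum 𝒜} {a b : A} (ha : a ∉ x.asHomogeneousIdeal)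
    (hb : b ∉ x.asHomogeneousIdeal) : a * b ∉ x.asHomogeneousIdeal :=
  x.asHomogeneousIdeal.toIdeal.primeCompl.mul_mem ha hb

theorem pow_notMem {x : ProjectiveSpectrum 𝒜} {a : A} (ha : a ∉ x.asHomogeneousIdeal) (n : ℕ) :
    a ^ n ∉ x.asHomogeneousIdeal :=
  x.asHomogeneousIdeal.toIdeal.primeCompl.pow_mem ha n

theorem one_notMem {x : ProjectiveSpectrum 𝒜} : (1 : A) ∉ x.asHomogeneousIdeal :=
  x.asHomogeneousIdeal.toIdeal.primeCompl.one_mem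

theorem notMem_of_le {ξ x : ProjectiveSpectrum 𝒜} (h : ξ ≤ x) {a : A}
    (ha : a ∉ x.asHomogeneousIdeal) : a ∉ ξ.asHomogeneousIdeal :=
  primeCompl_le h ha

theorem fraction_mul {x : ProjectiveSpectrum 𝒜} {d e : ℕ} {a s b t : A} (ha : a ∈ 𝒜 d)
    (hs : s ∈ 𝒜 d) (hsx : s ∉ x.asHomogeneousIdeal) (hb : b ∈ 𝒜 e) (ht : t ∈ 𝒜 e)
    (htx : t ∉ x.asHomogeneousIdeal) :
    fraction ha hs hsx * fraction hb ht htx =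
      fraction (SetLike.mul_mem_graded ha hb) (SetLike.mul_mem_graded hs ht)
        (mul_notMem hsx htx) := rfl

theorem fraction_pow {x : ProjectiveSpectrum 𝒜} {d : ℕ} {a s : A} (ha : a ∈ 𝒜 d)
    (hs : s ∈ 𝒜 d) (hsx : s ∉ x.asHomogeneousIdeal) (n : ℕ) :
    fraction ha hs hsx ^ n =
      fraction (SetLike.pow_mem_graded n ha) (SetLike.pow_mem_graded n hs)
        (pow_notMem hsx n) := rfl

theorem mapId_fraction {ξ x : ProjectiveSpectrum 𝒜} (h : ξ ≤ x) {d : ℕ} {a s : A} (ha : a ∈ 𝒜 d)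
    (hs : s ∈ 𝒜 d) (hsx : s ∉ x.asHomogeneousIdeal) :
    HomogeneousLocalization.mapId 𝒜 (primeCompl_le h) (fraction ha hs hsx) =
      fraction ha hs (notMem_of_le h hsx) := rfl

theorem fraction_eq_fraction_iff [IsDomain A] {x : ProjectiveSpectrum 𝒜} {d e : ℕ} {a s b t : A}
    {ha : a ∈ 𝒜 d} {hs : s ∈ 𝒜 d} {hsx : s ∉ x.asHomogeneousIdeal} {hb : b ∈ 𝒜 e} {ht : t ∈ 𝒜 e}
    {htx : t ∉ x.asHomogeneousIdeal} :
    fraction ha hs hsx = fraction hb ht htx ↔ a * t = b * s := by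
  rw [HomogeneousLocalization.ext_iff_val, fraction, fraction, HomogeneousLocalization.val_mk,
    HomogeneousLocalization.val_mk, Localization.mk_eq_mk_iff, Localization.r_iff_exists]
  constructor
  · rintro ⟨c, hc⟩
    have hc0 : (c : A) ≠ 0 := fun h => c.2 (h ▸ zero_mem _)
    have := mul_left_cancel₀ hc0 hc
    simp only at this
    linear_combination this
  · intro h
    refine ⟨1, ?_⟩
    rw [OneMemClass.coe_one]
    linear_combination h

theorem isUnit_fraction {x : ProjectiveSpectrum 𝒜} {d : ℕ} {a s : A} {ha : a ∈ 𝒜 d}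
    {hs : s ∈ 𝒜 d} {hsx : s ∉ x.asHomogeneousIdeal} (hax : a ∉ x.asHomogeneousIdeal) :
    IsUnit (fraction ha hs hsx) := by
  refine .of_mul_eq_one (fraction hs ha hax) ?_
  rw [fraction_mul, HomogeneousLocalization.ext_iff_val, HomogeneousLocalization.val_one]
  refine (HomogeneousLocalization.val_mk _).trans ?_
  rw [← Localization.mk_one, Localization.mk_eq_mk_iff, Localization.r_iff_exists]
  exact ⟨1, by simp [mul_comm]⟩

theorem notMem_of_isUnit_fraction [IsDomain A] {x : ProjectiveSpectrum 𝒜} {d : ℕ} {a s : A}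
    {ha : a ∈ 𝒜 d} {hs : s ∈ 𝒜 d} {hsx : s ∉ x.asHomogeneousIdeal}
    (h : IsUnit (fraction ha hs hsx)) : a ∉ x.asHomogeneousIdeal := by
  intro hax
  obtain ⟨u, hu⟩ := h.exists_right_inv
  obtain ⟨e, b, t, hb, ht, htx, rfl⟩ := exists_eq_fraction u
  have h1 : (1 : LocalRingAt 𝒜 x) = fraction SetLike.GradedOne.one_mem SetLike.GradedOne.one_mem
      one_notMem := rfl
  rw [fraction_mul, h1] at hu
  have := fraction_eq_fraction_iff.1 hu
  rw [mul_one, one_mul] at this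
  exact mul_notMem hsx htx (this ▸ x.asHomogeneousIdeal.toIdeal.mul_mem_right b hax)

end Graded

section Stalks
variable {A σ : Type u} [CommRing A] [SetLike σ A] [AddSubgroupClass σ A]
  (𝒜 : ℕ → σ) [GradedRing 𝒜]

theorem specializes_iff_le {ξ x : Proj 𝒜} :
    ξ ⤳ x ↔ (show ProjectiveSpectrum 𝒜 from ξ) ≤ (show ProjectiveSpectrum 𝒜 from x) := by
  rw [ProjectiveSpectrum.le_iff_mem_closure]
  exact specializes_iff_mem_closure

/-- The isomorphism between a stalk of `Proj` and a homogeneous localization, as a ring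
isomorphism. -/
noncomputable def stalkEquiv (x : Proj 𝒜) :
    (Proj 𝒜).presheaf.stalk x ≃+* LocalRingAt 𝒜 x :=
  (Proj.stalkIso 𝒜 x).commRingCatIsoToRingEquiv

theorem stalkEquiv_stalkSpecializes {ξ x : Proj 𝒜} (h : ξ ⤳ x) (u : (Proj 𝒜).presheaf.stalk x) :
    stalkEquiv 𝒜 ξ ((Proj 𝒜).presheaf.stalkSpecializes h u) =
      HomogeneousLocalization.mapId 𝒜 (primeCompl_le ((specializes_iff_le 𝒜).1 h))
        (stalkEquiv 𝒜 x u) := by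
  obtain ⟨u, rfl⟩ := (stalkEquiv 𝒜 x).symm.surjective u
  rw [RingEquiv.apply_symm_apply]
  obtain ⟨c, rfl⟩ := HomogeneousLocalization.mk_surjective u
  have hc : (stalkEquiv 𝒜 x).symm (.mk c) =
      (Proj 𝒜).presheaf.germ (Proj.basicOpen 𝒜 c.den) x c.den_mem
        (sectionInBasicOpen 𝒜 x c) := rfl
  rw [hc]
  refine (congrArg (stalkEquiv 𝒜 ξ) (TopCat.Presheaf.germ_stalkSpecializes_apply
    (Proj 𝒜).presheaf _ h _)).trans ?_
  exact Proj.stalkIso'_germ 𝒜 _ ξ _ _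

/-- For `Proj`, the scheme-theoretic property is the one on homogeneous localizations. -/
theorem powersAreLocal_proj_iff (g : ℕ) :
    PowersAreLocal g (Proj 𝒜) ↔ GradedPowersAreLocal 𝒜 g := by
  constructor
  · intro H ξ hξ f hf
    have hs : ∀ x : Proj 𝒜, (show Proj 𝒜 from ξ) ⤳ x := fun x => (specializes_iff_le 𝒜).2 (hξ x)
    obtain ⟨h, hh⟩ := H ξ hs ((stalkEquiv 𝒜 ξ).symm f) fun x hx => by
      obtain ⟨u, h, hu, e⟩ := hf x (hx.of_ringEquiv (stalkEquiv 𝒜 x))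
      refine ⟨(stalkEquiv 𝒜 x).symm u, (stalkEquiv 𝒜 ξ).symm h, hu.map (stalkEquiv 𝒜 x).symm, ?_⟩
      apply (stalkEquiv 𝒜 ξ).injective
      rw [map_mul, map_pow]
      refine Eq.trans ?_ (congrArg (· * _) (stalkEquiv_stalkSpecializes 𝒜 (hs x) _).symm)
      simpa using e
    exact ⟨stalkEquiv 𝒜 ξ h, by rw [← map_pow, ← hh, RingEquiv.apply_symm_apply]⟩
  · intro H ξ hξ f hf
    have hs : ∀ x : ProjectiveSpectrum 𝒜, (show ProjectiveSpectrum 𝒜 from ξ) ≤ x :=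
      fun x => (specializes_iff_le 𝒜).1 (hξ x)
    obtain ⟨h, hh⟩ := H ξ hs (stalkEquiv 𝒜 ξ f) fun x hx => by
      obtain ⟨u, h, hu, e⟩ := hf x (hx.of_ringEquiv (stalkEquiv 𝒜 x).symm)
      refine ⟨stalkEquiv 𝒜 x u, stalkEquiv 𝒜 ξ h, hu.map (stalkEquiv 𝒜 x), ?_⟩
      rw [e, map_mul, map_pow]
      exact congrArg (· * _) (stalkEquiv_stalkSpecializes 𝒜 (hξ x) u)
    exact ⟨(stalkEquiv 𝒜 ξ).symm h, by rw [← map_pow, ← hh, RingEquiv.symm_apply_apply]⟩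

end Stalks

/-! ### Graded factorial rings -/

section Factorial
variable {A σ : Type*} [CommRing A] [SetLike σ A] [AddSubgroupClass σ A]
  (𝒜 : ℕ → σ) [GradedRing 𝒜]

/-- The ring homomorphism `A → A[X]` sending `a` to `∑ aᵢ Xⁱ`, where `aᵢ` is the component of `a`
of degree `i`. -/
noncomputable def toPolynomial : A →+* Polynomial A :=
  (DirectSum.toSemiring
    (fun i => (Polynomial.monomial (R := A) i).toAddMonoidHom.comp
      (AddSubmonoidClass.subtype (𝒜 i)))
    (by simp [SetLike.coe_gOne])
    (by intro i j a b; simp [SetLike.coe_gMul, Polynomial.monomial_mul_monomial])).comp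
  (DirectSum.decomposeRingEquiv 𝒜).toRingHom

variable {𝒜}

theorem toPolynomial_of_mem {a : A} {i : ℕ} (ha : a ∈ 𝒜 i) :
    toPolynomial 𝒜 a = Polynomial.monomial i a := by
  have : DirectSum.decomposeRingEquiv 𝒜 a = DirectSum.of (fun i => 𝒜 i) i ⟨a, ha⟩ :=
    DirectSum.decompose_of_mem 𝒜 ha
  rw [toPolynomial, RingHom.comp_apply, RingEquiv.toRingHom_eq_coe, RingEquiv.coe_toRingHom, this]
  exact (DirectSum.toSemiring_of _ _ _ _ _).trans (by simp)

theorem toPolynomial_coeff_mem (a : A) (i : ℕ) : (toPolynomial 𝒜 a).coeff i ∈ 𝒜 i := by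
  classical
  rw [← DirectSum.sum_support_decompose 𝒜 a, map_sum, Polynomial.finsetSum_coeff]
  refine sum_mem fun j _ => ?_
  rw [toPolynomial_of_mem (SetLike.coe_mem _), Polynomial.coeff_monomial]
  split_ifs with h
  · exact h ▸ SetLike.coe_mem _
  · exact zero_mem _

theorem eval_one_toPolynomial (a : A) : (toPolynomial 𝒜 a).eval 1 = a := by
  classical
  conv_lhs => rw [← DirectSum.sum_support_decompose 𝒜 a]
  rw [map_sum, Polynomial.eval_finsetSum]
  conv_rhs => rw [← DirectSum.sum_support_decompose 𝒜 a]
  refine Finset.sum_congr rfl fun j _ => ?_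
  rw [toPolynomial_of_mem (SetLike.coe_mem _)]
  simp

/-- Factors of a nonzero homogeneous element of a graded domain are homogeneous: the degree and the
trailing degree of `toPolynomial` are both additive on products. -/
theorem exists_mem_of_mul_mem [IsDomain A] {a b : A} {n : ℕ} (h : a * b ∈ 𝒜 n) (h0 : a * b ≠ 0) :
    ∃ i, a ∈ 𝒜 i := by
  have hm : toPolynomial 𝒜 a * toPolynomial 𝒜 b = Polynomial.monomial n (a * b) := by
    rw [← map_mul, toPolynomial_of_mem h]
  have ha0 : toPolynomial 𝒜 a ≠ 0 := by
    rintro h'; exact h0 (by simpa [h'] using hm.symm)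
  have hb0 : toPolynomial 𝒜 b ≠ 0 := by
    rintro h'; exact h0 (by simpa [h'] using hm.symm)
  have h1 := Polynomial.natDegree_mul ha0 hb0
  have h2 := Polynomial.natTrailingDegree_mul ha0 hb0
  rw [hm, Polynomial.natDegree_monomial_eq _ h0] at h1
  rw [hm, Polynomial.natTrailingDegree_monomial h0] at h2
  have h3 := Polynomial.natTrailingDegree_le_natDegree (toPolynomial 𝒜 a)
  have h4 := Polynomial.natTrailingDegree_le_natDegree (toPolynomial 𝒜 b)
  have hc : toPolynomial 𝒜 a = Polynomial.monomial (toPolynomial 𝒜 a).natDegree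
      ((toPolynomial 𝒜 a).coeff (toPolynomial 𝒜 a).natDegree) := by
    ext j
    rw [Polynomial.coeff_monomial]
    split_ifs with hj
    · rw [hj]
    · rcases lt_or_gt_of_ne hj with hj | hj
      · exact Polynomial.coeff_eq_zero_of_natDegree_lt hj
      · exact Polynomial.coeff_eq_zero_of_lt_natTrailingDegree (by omega)
  refine ⟨(toPolynomial 𝒜 a).natDegree, ?_⟩
  have h5 := eval_one_toPolynomial (𝒜 := 𝒜) a
  rw [hc, Polynomial.eval_monomial, one_pow, mul_one] at h5
  nth_rw 2 [← h5]
  exact toPolynomial_coeff_mem a _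

theorem exists_mem_of_dvd [IsDomain A] {a b : A} {n : ℕ} (hb : b ∈ 𝒜 n) (h0 : b ≠ 0)
    (h : a ∣ b) : ∃ i, a ∈ 𝒜 i := by
  obtain ⟨c, rfl⟩ := h
  exact exists_mem_of_mul_mem hb h0

/-- An element all of whose prime multiplicities are divisible by `g` is a `g`-th power up to a
unit. -/
theorem exists_associated_pow [IsDomain A] [UniqueFactorizationMonoid A] {g : ℕ}
    {a : A} (ha : a ≠ 0) (h : ∀ p, Irreducible p → p ∣ a → g ∣ multiplicity p a) :
    ∃ r, Associated (r ^ g) a := by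
  classical
  let : StrongNormalizationMonoid A := UniqueFactorizationMonoid.strongNormalizationMonoid
  obtain ⟨m, hm⟩ := Multiset.exists_smul_of_dvd_count
    (UniqueFactorizationMonoid.normalizedFactors a) (k := g) (fun p hp => by
      have hp' := UniqueFactorizationMonoid.irreducible_of_normalized_factor p hp
      have := UniqueFactorizationMonoid.multiplicity_eq_count_normalizedFactors hp' ha
      rw [UniqueFactorizationMonoid.normalize_normalized_factor p hp] at this
      rw [← this]
      exact h p hp' (UniqueFactorizationMonoid.dvd_of_mem_normalizedFactors hp))
  refine ⟨m.prod, ?_⟩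
  rw [← Multiset.prod_nsmul, ← hm]
  exact UniqueFactorizationMonoid.prod_normalizedFactors ha

/-- The point of `Proj` defined by a homogeneous prime element. -/
def primePoint {p : A} (hp : Prime p) {n : ℕ} (hpn : p ∈ 𝒜 n)
    (hirr : ¬ (HomogeneousIdeal.irrelevant 𝒜).toIdeal ≤ Ideal.span {p}) : ProjectiveSpectrum 𝒜 where
  asHomogeneousIdeal := ⟨Ideal.span {p}, Ideal.homogeneous_span 𝒜 _ (by
    rintro _ rfl; exact ⟨n, hpn⟩)⟩
  isPrime := (Ideal.span_singleton_prime hp.ne_zero).2 hp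
  not_irrelevant_le := hirr

theorem mem_primePoint {p : A} (hp : Prime p) {n : ℕ} (hpn : p ∈ 𝒜 n)
    (hirr : ¬ (HomogeneousIdeal.irrelevant 𝒜).toIdeal ≤ Ideal.span {p}) {a : A} :
    a ∈ (primePoint hp hpn hirr).asHomogeneousIdeal ↔ p ∣ a :=
  Ideal.mem_span_singleton

/-- The local ring at the point of a homogeneous prime element is a valuation ring. -/
theorem dvdTotal_primePoint [IsDomain A] [UniqueFactorizationMonoid A] {p : A} (hp : Prime p)
    {n : ℕ} (hpn : p ∈ 𝒜 n)
    (hirr : ¬ (HomogeneousIdeal.irrelevant 𝒜).toIdeal ≤ Ideal.span {p}) :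
    DvdTotal (LocalRingAt 𝒜 (primePoint hp hpn hirr)) := by
  intro x y
  obtain ⟨d, a, s, ha, hs, hsx, rfl⟩ := exists_eq_fraction x
  obtain ⟨e, b, t, hb, ht, htx, rfl⟩ := exists_eq_fraction y
  by_cases ha0 : a = 0
  · right
    refine ⟨fraction (zero_mem (𝒜 0)) SetLike.GradedOne.one_mem one_notMem, ?_⟩
    rw [fraction_mul, fraction_eq_fraction_iff]
    simp [ha0]
  by_cases hb0 : b = 0
  · left
    refine ⟨fraction (zero_mem (𝒜 0)) SetLike.GradedOne.one_mem one_notMem, ?_⟩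
    rw [fraction_mul, fraction_eq_fraction_iff]
    simp [hb0]
  have key : ∀ {d e : ℕ} {a s b t : A} (ha : a ∈ 𝒜 d) (hs : s ∈ 𝒜 d)
      (hsx : s ∉ (primePoint hp hpn hirr).asHomogeneousIdeal) (hb : b ∈ 𝒜 e) (ht : t ∈ 𝒜 e)
      (htx : t ∉ (primePoint hp hpn hirr).asHomogeneousIdeal), a ≠ 0 → b ≠ 0 →
      (∀ i, p ^ i ∣ a → p ^ i ∣ b) → fraction ha hs hsx ∣ fraction hb ht htx := by
    intro d e a s b t ha hs hsx hb ht htx ha0 hb0 hab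
    have hfin := FiniteMultiplicity.of_prime_left hp ha0
    obtain ⟨a', haa, hpa'⟩ := hfin.exists_eq_pow_mul_and_not_dvd
    obtain ⟨b', hbb⟩ := hab _ ⟨a', haa⟩
    generalize multiplicity p a = i at *
    obtain ⟨m, ha'⟩ := exists_mem_of_dvd ha ha0 ⟨p ^ i, by rw [haa, mul_comm]⟩
    obtain ⟨l, hb'⟩ := exists_mem_of_dvd hb hb0 ⟨p ^ i, by rw [hbb, mul_comm]⟩
    have hpi : p ^ i ∈ 𝒜 (i • n) := SetLike.pow_mem_graded i hpn
    have hd : d = i • n + m := DirectSum.degree_eq_of_mem_mem 𝒜 ha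
      (haa ▸ SetLike.mul_mem_graded hpi ha') ha0
    have he : e = i • n + l := DirectSum.degree_eq_of_mem_mem 𝒜 hb
      (hbb ▸ SetLike.mul_mem_graded hpi hb') hb0
    have hdeg : l + d = m + e := by omega
    refine ⟨fraction (SetLike.mul_mem_graded hb' hs) (hdeg ▸ SetLike.mul_mem_graded ha' ht)
      (mul_notMem (fun h => hpa' ((mem_primePoint hp hpn hirr).1 h)) htx), ?_⟩
    rw [fraction_mul, fraction_eq_fraction_iff, haa, hbb]
    ring
  by_cases h : ∀ i, p ^ i ∣ a → p ^ i ∣ b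
  · exact Or.inl (key _ _ _ _ _ _ ha0 hb0 h)
  · refine Or.inr (key _ _ _ _ _ _ hb0 ha0 fun j hj => ?_)
    push Not at h
    obtain ⟨i, hia, hib⟩ := h
    rcases le_total i j with hij | hij
    · exact absurd ((pow_dvd_pow p hij).trans hj) hib
    · exact (pow_dvd_pow p hij).trans hia

/-- In a graded factorial domain whose units are `g`-th powers, a rational function which is locally
a `g`-th power up to units is a `g`-th power: all its prime multiplicities are divisible by `g`. -/
theorem gradedPowersAreLocal_of_uniqueFactorizationMonoid [IsDomain A]
    [UniqueFactorizationMonoid A] {g : ℕ} (hg : 0 < g) (hunit : ∀ c : Aˣ, ∃ c' : A, c' ^ g = c)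
    (hirr : ∀ p : A, Prime p → ¬ (HomogeneousIdeal.irrelevant 𝒜).toIdeal ≤ Ideal.span {p}) :
    GradedPowersAreLocal 𝒜 g := by
  intro ξ hξ f hf
  obtain ⟨d, a, s, ha, hs, hsξ, rfl⟩ := exists_eq_fraction f
  have hs0 : s ≠ 0 := fun h => hsξ (h ▸ zero_mem _)
  by_cases ha0 : a = 0
  · refine ⟨0, ?_⟩
    have h0 : (0 : LocalRingAt 𝒜 ξ) = fraction (zero_mem (𝒜 0)) SetLike.GradedOne.one_mem
      one_notMem := rfl
    rw [zero_pow hg.ne', h0, fraction_eq_fraction_iff, ha0, zero_mul, zero_mul]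
  -- `f = a / s = b / s ^ g`, so it suffices to extract a root of `b`.
  set b := a * s ^ (g - 1) with hb
  have hgd : d + (g - 1) * d = g * d := by
    obtain ⟨g, rfl⟩ := Nat.exists_eq_succ_of_ne_zero hg.ne'
    simp; ring
  have hbmem : b ∈ 𝒜 (g * d) := by
    have := SetLike.mul_mem_graded ha (SetLike.pow_mem_graded (g - 1) hs)
    rwa [smul_eq_mul, hgd] at this
  have hb0 : b ≠ 0 := mul_ne_zero ha0 (pow_ne_zero _ hs0)
  obtain ⟨r, c, hrc⟩ : ∃ r, Associated (r ^ g) b := by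
    refine exists_associated_pow hb0 fun p hpirr hpb => ?_
    have hp := hpirr.prime
    obtain ⟨n, hpn⟩ := exists_mem_of_dvd hbmem hb0 hpb
    obtain ⟨u, h, hu, hfuh⟩ := hf (primePoint hp hpn (hirr p hp))
      (dvdTotal_primePoint hp hpn (hirr p hp))
    obtain ⟨e, u₁, u₂, hu₁, hu₂, hu₂x, rfl⟩ := exists_eq_fraction u
    obtain ⟨l, h₁, h₂, hh₁, hh₂, hh₂ξ, rfl⟩ := exists_eq_fraction h
    have hu₁x := notMem_of_isUnit_fraction hu
    rw [mapId_fraction (hξ _), fraction_pow, fraction_mul, fraction_eq_fraction_iff] at hfuh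
    rw [mem_primePoint] at hu₁x hu₂x
    have hh₂0 : h₂ ≠ 0 := fun h => hh₂ξ (h ▸ zero_mem _)
    have hu₂0 : u₂ ≠ 0 := fun h => hu₂x (h ▸ dvd_zero _)
    have hL0 : a * (u₂ * h₂ ^ g) ≠ 0 := mul_ne_zero ha0 (mul_ne_zero hu₂0 (pow_ne_zero _ hh₂0))
    have fin : ∀ {x : A}, x ≠ 0 → FiniteMultiplicity p x :=
      fun hx => FiniteMultiplicity.of_prime_left hp hx
    have hv := congrArg (multiplicity p) hfuh
    have hR0 := hL0
    rw [hfuh] at hR0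
    have hh₁0 : h₁ ^ g ≠ 0 := right_ne_zero_of_mul (left_ne_zero_of_mul hR0)
    rw [multiplicity_mul hp (fin hL0), multiplicity_mul hp (fin (right_ne_zero_of_mul hL0)),
      multiplicity_mul hp (fin hR0), multiplicity_mul hp (fin (left_ne_zero_of_mul hR0)),
      multiplicity_eq_zero.2 hu₁x, multiplicity_eq_zero.2 hu₂x,
      (fin hh₂0).multiplicity_pow hp, (fin (ne_zero_pow hg.ne' hh₁0)).multiplicity_pow hp] at hv
    rw [hb, multiplicity_mul hp (fin hb0), (fin hs0).multiplicity_pow hp]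
    obtain ⟨g, rfl⟩ := Nat.exists_eq_succ_of_ne_zero hg.ne'
    refine (Nat.dvd_add_left (Dvd.intro (multiplicity p h₂) rfl)).1
      (⟨multiplicity p h₁ + multiplicity p s, ?_⟩ : g.succ ∣ _ + g.succ * multiplicity p h₂)
    simp only [Nat.succ_eq_add_one, Nat.add_sub_cancel] at hv ⊢
    linarith
  obtain ⟨c', hc'⟩ := hunit c
  have hroot : (r * c') ^ g = b := by rw [mul_pow, hc', hrc]
  obtain ⟨e, hre⟩ := exists_mem_of_dvd hbmem hb0 (hroot ▸ dvd_pow_self (r * c') hg.ne')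
  have hed : e = d := by
    have := DirectSum.degree_eq_of_mem_mem 𝒜 (SetLike.pow_mem_graded g hre) (hroot ▸ hbmem)
      (hroot ▸ hb0)
    exact Nat.eq_of_mul_eq_mul_left hg this
  subst hed
  refine ⟨fraction hre hs hsξ, ?_⟩
  rw [fraction_pow, fraction_eq_fraction_iff, hroot, hb, mul_assoc, ← pow_succ,
    Nat.sub_add_cancel hg]

end Factorial

section Weighted
variable {k : Type u} [Field k] [IsAlgClosed k]

/-- The polynomial ring is factorial and its units are constants, hence `g`-th powers; and no prime
element divides all three variables. -/
theorem powersAreLocal_weightedProjectivePlane {g : ℕ} (hg : 0 < g) {w : Fin 3 → ℕ}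
    (hw : ∀ i, 0 < w i) : PowersAreLocal g (weightedProjectivePlane k w).left := by
  let := MvPolynomial.weightedGradedAlgebra k w
  change PowersAreLocal g (Proj (MvPolynomial.weightedHomogeneousSubmodule k w))
  rw [powersAreLocal_proj_iff]
  apply gradedPowersAreLocal_of_uniqueFactorizationMonoid hg
  · intro c
    obtain ⟨r, hr, hrc⟩ := MvPolynomial.isUnit_iff_eq_C_of_isReduced.1 c.isUnit
    obtain ⟨z, rfl⟩ := IsAlgClosed.exists_pow_nat_eq r hg
    exact ⟨MvPolynomial.C z, by rw [hrc, map_pow]⟩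
  · intro p hp hle
    have hX : ∀ i, p ∣ (MvPolynomial.X i : MvPolynomial (Fin 3) k) := fun i => by
      rw [← Ideal.mem_span_singleton]
      apply hle
      refine (HomogeneousIdeal.mem_irrelevant_iff _ _).2 ?_
      rw [GradedRing.proj_apply]
      exact DirectSum.decompose_of_mem_ne _ (MvPolynomial.isWeightedHomogeneous_X k w i)
        (hw i).ne'
    have h0 : Associated p (MvPolynomial.X 0 : MvPolynomial (Fin 3) k) :=
      (hp.irreducible.associated_of_dvd MvPolynomial.X_prime.irreducible (hX 0))
    have h01 := h0.symm.dvd.trans (hX 1)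
    rw [MvPolynomial.X_dvd_X] at h01
    exact absurd h01 (by decide)

end Weighted

/-! ### Barycentric coordinates -/

namespace RationalTriangle
variable (Δ : RationalTriangle)

/-- Twice the signed area of the triangle. -/
def area : ℚ :=
  ((Δ.vertex 1).1 - (Δ.vertex 0).1) * ((Δ.vertex 2).2 - (Δ.vertex 0).2) -
    ((Δ.vertex 2).1 - (Δ.vertex 0).1) * ((Δ.vertex 1).2 - (Δ.vertex 0).2)

/-- The homogeneous barycentric coordinates: `coord i (d, m)` is the coefficient of the vertex `vᵢ`
in the expression of `m` as a combination of the vertices with coefficients of sum `d`. -/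
def coord (i : Fin 3) : ℕ × (ℤ × ℤ) →+ ℚ where
  toFun x := (x.2.1 * ((Δ.vertex (i + 1)).2 - (Δ.vertex (i + 2)).2) -
    x.2.2 * ((Δ.vertex (i + 1)).1 - (Δ.vertex (i + 2)).1) +
    x.1 * ((Δ.vertex (i + 1)).1 * (Δ.vertex (i + 2)).2 -
      (Δ.vertex (i + 2)).1 * (Δ.vertex (i + 1)).2)) / Δ.area
  map_zero' := by simp
  map_add' x y := by push_cast [Prod.fst_add, Prod.snd_add]; ring

theorem coord_apply (i : Fin 3) (x : ℕ × (ℤ × ℤ)) : Δ.coord i x =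
    (x.2.1 * ((Δ.vertex (i + 1)).2 - (Δ.vertex (i + 2)).2) -
    x.2.2 * ((Δ.vertex (i + 1)).1 - (Δ.vertex (i + 2)).1) +
    x.1 * ((Δ.vertex (i + 1)).1 * (Δ.vertex (i + 2)).2 -
      (Δ.vertex (i + 2)).1 * (Δ.vertex (i + 1)).2)) / Δ.area := rfl

variable {Δ}

theorem sum_coord (h : Δ.area ≠ 0) (x : ℕ × (ℤ × ℤ)) : ∑ i, Δ.coord i x = x.1 := by
  simp only [Fin.sum_univ_three, coord_apply, Fin.reduceAdd, zero_add]
  field_simp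
  rw [area]
  ring

theorem sum_coord_mul_fst (h : Δ.area ≠ 0) (x : ℕ × (ℤ × ℤ)) :
    ∑ i, Δ.coord i x * (Δ.vertex i).1 = x.2.1 := by
  simp only [Fin.sum_univ_three, coord_apply, Fin.reduceAdd, zero_add]
  field_simp
  rw [area]
  ring

theorem sum_coord_mul_snd (h : Δ.area ≠ 0) (x : ℕ × (ℤ × ℤ)) :
    ∑ i, Δ.coord i x * (Δ.vertex i).2 = x.2.2 := by
  simp only [Fin.sum_univ_three, coord_apply, Fin.reduceAdd, zero_add]
  field_simp
  rw [area]
  ring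

theorem coord_eq_of_sum (h : Δ.area ≠ 0) (x : ℕ × (ℤ × ℤ)) (c : Fin 3 → ℝ)
    (h₀ : ∑ i, c i = x.1) (h₁ : ∑ i, c i * (Δ.vertex i).1 = x.2.1)
    (h₂ : ∑ i, c i * (Δ.vertex i).2 = x.2.2) (i : Fin 3) : (Δ.coord i x : ℝ) = c i := by
  have h' : (Δ.area : ℝ) ≠ 0 := by exact_mod_cast h
  rw [coord_apply]
  push_cast
  rw [← h₀, ← h₁, ← h₂, div_eq_iff h', area]
  push_cast
  fin_cases i <;> simp [Fin.sum_univ_three] <;> ring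

/-- The lattice points of the multiples of the triangle are those with nonnegative coordinates. -/
theorem mem_semigroup_iff (h : Δ.area ≠ 0) (x : ℕ × (ℤ × ℤ)) :
    x ∈ Δ.semigroup ↔ ∀ i, 0 ≤ Δ.coord i x := by
  change ((x.2.1 : ℝ), (x.2.2 : ℝ)) ∈ (x.1 : ℝ) • Δ.region ↔ _
  constructor
  · rintro ⟨p, hp, hpx⟩
    have hsub : Δ.region ⊆ {p | ∃ w : Fin 3 → ℝ, (∀ i, 0 ≤ w i) ∧ ∑ i, w i = 1 ∧
        ∑ i, w i * (Δ.vertex i).1 = p.1 ∧ ∑ i, w i * (Δ.vertex i).2 = p.2} := by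
      refine convexHull_min ?_ ?_
      · rintro _ ⟨i, rfl⟩
        exact ⟨Pi.single i 1, fun j => by by_cases hj : j = i <;> simp [hj],
          by simp, by simp [Pi.single_apply], by simp [Pi.single_apply]⟩
      · rintro p ⟨w, hw, hw1, hp1, hp2⟩ q ⟨v, hv, hv1, hq1, hq2⟩ α β hα hβ hαβ
        refine ⟨fun i => α * w i + β * v i, fun i => by have := hw i; have := hv i; positivity,
          ?_, ?_, ?_⟩
        · rw [Finset.sum_add_distrib, ← Finset.mul_sum, ← Finset.mul_sum, hw1, hv1]; linarith
        · simp only [Prod.fst_add, Prod.smul_fst, smul_eq_mul, ← hp1, ← hq1, Finset.mul_sum,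
            ← Finset.sum_add_distrib]
          exact Finset.sum_congr rfl fun i _ => by ring
        · simp only [Prod.snd_add, Prod.smul_snd, smul_eq_mul, ← hp2, ← hq2, Finset.mul_sum,
            ← Finset.sum_add_distrib]
          exact Finset.sum_congr rfl fun i _ => by ring
    obtain ⟨w, hw, hw1, hp1, hp2⟩ := hsub hp
    intro i
    have hx1 := congrArg Prod.fst hpx
    have hx2 := congrArg Prod.snd hpx
    simp only [Prod.smul_fst, Prod.smul_snd, smul_eq_mul] at hx1 hx2
    have := coord_eq_of_sum h x (fun i => x.1 * w i) (by rw [← Finset.mul_sum, hw1, mul_one])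
      (by simp only [mul_assoc]; rw [← Finset.mul_sum, hp1, hx1])
      (by simp only [mul_assoc]; rw [← Finset.mul_sum, hp2, hx2]) i
    have h0 : (0 : ℝ) ≤ Δ.coord i x := this ▸ mul_nonneg (Nat.cast_nonneg _) (hw i)
    exact_mod_cast h0
  · intro hx
    have e0 := sum_coord h x
    have e1 := sum_coord_mul_fst h x
    have e2 := sum_coord_mul_snd h x
    rcases Nat.eq_zero_or_pos x.1 with hd | hd
    · have hz : ∀ i, Δ.coord i x = 0 := fun i => by
        rw [hd, Nat.cast_zero] at e0
        exact (Finset.sum_eq_zero_iff_of_nonneg fun i _ => hx i).1 e0 i (Finset.mem_univ i)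
      simp only [hz, zero_mul, Finset.sum_const_zero] at e1 e2
      rw [hd, Nat.cast_zero, Set.zero_smul_set Δ.region_nonempty,
        Int.cast_eq_zero.1 e1.symm, Int.cast_eq_zero.1 e2.symm, Int.cast_zero]
      exact Set.zero_mem_zero
    · have hd' : (x.1 : ℝ) ≠ 0 := by positivity
      refine Set.mem_smul_set.2 ⟨((x.2.1 : ℝ) / x.1, (x.2.2 : ℝ) / x.1), ?_, ?_⟩
      · refine mem_convexHull_of_exists_fintype (fun i => (Δ.coord i x : ℝ) / x.1)
          (fun i => (((Δ.vertex i).1 : ℝ), ((Δ.vertex i).2 : ℝ)))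
          (fun i => div_nonneg (by exact_mod_cast hx i) (Nat.cast_nonneg _)) ?_
          (fun i => ⟨i, rfl⟩) ?_
        · rw [← Finset.sum_div, div_eq_one_iff_eq hd']
          exact_mod_cast e0
        · ext
          · simp only [Prod.fst_sum, Prod.smul_fst, smul_eq_mul, div_mul_eq_mul_div,
              ← Finset.sum_div]
            congr 1
            exact_mod_cast e1
          · simp only [Prod.snd_sum, Prod.smul_snd, smul_eq_mul, div_mul_eq_mul_div,
              ← Finset.sum_div]
            congr 1
            exact_mod_cast e2
      · ext <;> simp <;> field_simp

variable (Δ) in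
/-- Some positive multiple of the triangle has its vertices in the lattice. -/
theorem exists_lattice_multiple : ∃ (N : ℕ) (V : Fin 3 → ℤ × ℤ), 0 < N ∧
    ∀ i, ((V i).1 : ℚ) = N * (Δ.vertex i).1 ∧ ((V i).2 : ℚ) = N * (Δ.vertex i).2 := by
  have key : ∀ (q : ℚ) (n : ℕ), q.den ∣ n → ∃ z : ℤ, (z : ℚ) = n * q := by
    rintro q _ ⟨n, rfl⟩
    refine ⟨n * q.num, ?_⟩
    have := Rat.den_mul_eq_num q
    push_cast
    rw [← this]; ring
  set N := ∏ i, ((Δ.vertex i).1.den * (Δ.vertex i).2.den) with hN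
  have hdvd : ∀ i, (Δ.vertex i).1.den * (Δ.vertex i).2.den ∣ N :=
    fun i => Finset.dvd_prod_of_mem _ (Finset.mem_univ i)
  choose X hX using fun i => key (Δ.vertex i).1 N ((Dvd.intro _ rfl).trans (hdvd i))
  choose Y hY using fun i => key (Δ.vertex i).2 N ((Dvd.intro_left _ rfl).trans (hdvd i))
  exact ⟨N, fun i => (X i, Y i), Finset.prod_pos fun i _ => Nat.mul_pos (Rat.den_pos _)
    (Rat.den_pos _), fun i => ⟨hX i, hY i⟩⟩

theorem coord_lattice_vertex (h : Δ.area ≠ 0) {N : ℕ} {V : Fin 3 → ℤ × ℤ}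
    (hV : ∀ i, ((V i).1 : ℚ) = N * (Δ.vertex i).1 ∧ ((V i).2 : ℚ) = N * (Δ.vertex i).2)
    (i j : Fin 3) : Δ.coord i (N, V j) = if i = j then (N : ℚ) else 0 := by
  have := coord_eq_of_sum h (N, V j) (Pi.single j (N : ℝ)) (by simp)
    (by simp [Pi.single_apply]; exact_mod_cast (hV j).1.symm)
    (by simp [Pi.single_apply]; exact_mod_cast (hV j).2.symm) i
  rw [Pi.single_apply] at this
  split_ifs at this ⊢ <;> exact_mod_cast this

end RationalTriangle

/-! ### The semigroup algebra of a triangle -/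

namespace RationalTriangle
variable {k : Type u} [Field k] {Δ : RationalTriangle}

instance : IsDomain (AddMonoidAlgebra k Δ.semigroup) :=
  have : UniqueSums Δ.semigroup :=
    UniqueSums.of_injective_addHom (Δ.semigroup.subtype : Δ.semigroup →ₙ+ ℕ × (ℤ × ℤ))
      Subtype.val_injective inferInstance
  NoZeroDivisors.to_isDomain _

variable (k) in
/-- The monomial `χᵐ` in degree `d`, for `(d, m)` in the semigroup of the triangle. -/
noncomputable def mono (x : Δ.semigroup) : AddMonoidAlgebra k Δ.semigroup :=
  AddMonoidAlgebra.single x 1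

theorem mono_add (x y : Δ.semigroup) : mono k (x + y) = mono k x * mono k y := by
  simp [mono, AddMonoidAlgebra.single_mul_single]

theorem mono_nsmul (n : ℕ) (x : Δ.semigroup) : mono k (n • x) = mono k x ^ n := by
  simp [mono, AddMonoidAlgebra.single_pow]

theorem mono_ne_zero (x : Δ.semigroup) : mono k x ≠ 0 := by
  simp [mono]

theorem mono_mem (x : Δ.semigroup) :
    mono k x ∈ AddMonoidAlgebra.gradeBy k Δ.degree x.1.1 :=
  AddMonoidAlgebra.single_mem_gradeBy Δ.degree x 1

/-- An element outside an ideal has a monomial outside that ideal. -/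
theorem exists_mono_notMem (I : Ideal (AddMonoidAlgebra k Δ.semigroup))
    {b : AddMonoidAlgebra k Δ.semigroup} (hb : b ∉ I) : ∃ z ∈ b.coeff.support, mono k z ∉ I := by
  by_contra! H
  apply hb
  rw [← AddMonoidAlgebra.sum_coeff_single b]
  refine sum_mem fun z hz => ?_
  have : AddMonoidAlgebra.single z (b.coeff z) =
      AddMonoidAlgebra.single 0 (b.coeff z) * mono k z := by
    simp [mono, AddMonoidAlgebra.single_mul_single]
  rw [this]
  exact I.mul_mem_left _ (H z hz)

theorem coord_nonneg (h : Δ.area ≠ 0) (x : Δ.semigroup) (i : Fin 3) : 0 ≤ Δ.coord i x :=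
  (mem_semigroup_iff h _).1 x.2 i

section Points

variable (h : Δ.area ≠ 0) {N : ℕ} (hN : 0 < N) {v : Fin 3 → Δ.semigroup}
  (hv : ∀ i j, Δ.coord i (v j) = if i = j then (N : ℚ) else 0)
include h hv

theorem degree_lattice_vertex (j : Fin 3) : (v j).1.1 = N := by
  have := sum_coord h (v j : ℕ × (ℤ × ℤ))
  simp only [hv, Finset.sum_ite_eq', Finset.mem_univ, if_true] at this
  exact_mod_cast this.symm

/-- A monomial with a positive coordinate along a vertex lies in every prime that contains the
monomial of that vertex: some power of it is a multiple of the vertex monomial. -/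
theorem mono_mem_of_coord_pos {I : Ideal (AddMonoidAlgebra k Δ.semigroup)} (hI : I.IsPrime)
    {i : Fin 3} (hi : mono k (v i) ∈ I) {x : Δ.semigroup} (hx : 0 < Δ.coord i x) :
    mono k x ∈ I := by
  -- For this `K`, the coordinate of `K • x` along `v i` is at least that of `v i`.
  obtain ⟨K, hK⟩ := exists_nat_ge ((N : ℚ) / Δ.coord i x)
  rw [div_le_iff₀ hx] at hK
  have hdeg := degree_lattice_vertex h hv i
  have hle : N ≤ K * x.1.1 := by
    have h1 := sum_coord h (x : ℕ × (ℤ × ℤ))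
    have h2 : Δ.coord i x ≤ x.1.1 := by
      rw [← h1]
      exact Finset.single_le_sum (fun j _ => coord_nonneg h x j) (Finset.mem_univ i)
    have h3 : (N : ℚ) ≤ K * x.1.1 := hK.trans (mul_le_mul_of_nonneg_left h2 (Nat.cast_nonneg K))
    exact_mod_cast h3
  set y : ℕ × (ℤ × ℤ) := (K * x.1.1 - N, K • x.1.2 - (v i).1.2) with hy
  have hsum : K • (x : ℕ × (ℤ × ℤ)) = (v i : ℕ × (ℤ × ℤ)) + y := by
    refine Prod.ext ?_ ?_
    · rw [Prod.fst_add, hdeg, hy, Prod.smul_fst, smul_eq_mul]; omega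
    · rw [Prod.snd_add, hy, Prod.smul_snd, add_sub_cancel]
  have hymem : y ∈ Δ.semigroup := by
    rw [mem_semigroup_iff h]
    intro j
    have := congrArg (Δ.coord j) hsum
    rw [map_add, map_nsmul, nsmul_eq_mul, hv] at this
    have h0 := coord_nonneg h x j
    split_ifs at this with hj
    · subst hj; linarith
    · have : 0 ≤ (K : ℚ) * Δ.coord j x := by positivity
      linarith
  have : K • x = v i + ⟨y, hymem⟩ := Subtype.ext hsum
  apply hI.mem_of_pow_mem K
  rw [← mono_nsmul, this, mono_add]
  exact I.mul_mem_right _ hi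

/-- The toric surface is covered by the charts of the three vertices. -/
theorem exists_vertex_notMem (x : ProjectiveSpectrum (AddMonoidAlgebra.gradeBy k Δ.degree)) :
    ∃ i, mono k (v i) ∉ x.asHomogeneousIdeal := by
  by_contra! H
  apply x.not_irrelevant_le
  refine (HomogeneousIdeal.toIdeal_irrelevant_le _).2 fun d hd b hb => ?_
  by_contra hbx
  obtain ⟨z, hz, hzx⟩ := exists_mono_notMem _ hbx
  have hzd : z.1.1 = d := hb z hz
  obtain ⟨i, hi⟩ : ∃ i, 0 < Δ.coord i z := by
    by_contra! H'
    have h1 := sum_coord h (z : ℕ × (ℤ × ℤ))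
    have h2 : ∑ i, Δ.coord i z ≤ 0 := Finset.sum_nonpos fun i _ => H' i
    rw [h1, hzd] at h2
    have : 0 < (d : ℚ) := by exact_mod_cast hd
    linarith
  exact hzx (mono_mem_of_coord_pos h hv x.isPrime (H i) hi)

include hN

/-- At a point outside the chart of `v j`, the monomial of `v j` divides the monomial of no other
vertex in the local ring. -/
theorem not_dvd_of_mem {x : ProjectiveSpectrum (AddMonoidAlgebra.gradeBy k Δ.degree)}
    {i j l : Fin 3} (hjl : j ≠ l) (hi : mono k (v i) ∉ x.asHomogeneousIdeal)
    (hj : mono k (v j) ∈ x.asHomogeneousIdeal) {m : ℕ}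
    {hvi : mono k (v i) ∈ AddMonoidAlgebra.gradeBy k Δ.degree m}
    {hvj : mono k (v j) ∈ AddMonoidAlgebra.gradeBy k Δ.degree m}
    {hvl : mono k (v l) ∈ AddMonoidAlgebra.gradeBy k Δ.degree m} :
    ¬ (fraction hvj hvi hi ∣ fraction hvl hvi hi) := by
  rintro ⟨c, hc⟩
  obtain ⟨d, F, G, hF, hG, hGx, rfl⟩ := exists_eq_fraction c
  rw [fraction_mul] at hc
  have hc' := fraction_eq_fraction_iff.1 hc
  have hc'' : mono k (v l) * G = mono k (v j) * F := by
    apply mul_left_cancel₀ (mono_ne_zero (k := k) (v i))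
    linear_combination hc'
  -- A monomial `z` of the denominator outside the prime has coordinate zero along `v j`; comparing
  -- the coordinates along `v j` of the monomial `v l + z` on both sides gives a contradiction.
  obtain ⟨z, hz, hzx⟩ := exists_mono_notMem _ hGx
  have hzj : Δ.coord j z ≤ 0 := by
    by_contra! H
    exact hzx (mono_mem_of_coord_pos h hv x.isPrime hj H)
  have hz' : (mono k (v l) * G).coeff (v l + z) ≠ 0 := by
    rw [mono, AddMonoidAlgebra.coeff_single_mul_add, one_mul]
    exact Finsupp.mem_support_iff.1 hz
  rw [hc''] at hz'
  obtain ⟨z', hz'⟩ : ∃ z', v j + z' = v l + z := by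
    by_contra! H
    exact hz' (AddMonoidAlgebra.coeff_single_mul_of_forall_add_ne _ _ H)
  have := congrArg (fun y : Δ.semigroup => Δ.coord j y) hz'
  simp only [AddSubmonoid.coe_add, map_add, hv, if_true, if_neg hjl] at this
  have h1 := coord_nonneg h z' j
  have : (0 : ℚ) < N := by exact_mod_cast hN
  linarith

/-- A point whose local ring is a valuation ring lies in the charts of two of the vertices, so it
avoids the torus fixed points. -/
theorem exists_two_vertices_notMem
    {x : ProjectiveSpectrum (AddMonoidAlgebra.gradeBy k Δ.degree)}
    (hx : DvdTotal (LocalRingAt (AddMonoidAlgebra.gradeBy k Δ.degree) x)) :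
    ∃ i j, i ≠ j ∧ mono k (v i) ∉ x.asHomogeneousIdeal ∧ mono k (v j) ∉ x.asHomogeneousIdeal := by
  obtain ⟨i, hi⟩ := exists_vertex_notMem (k := k) h hv x
  by_cases h1 : mono k (v (i + 1)) ∈ x.asHomogeneousIdeal
  · by_cases h2 : mono k (v (i + 2)) ∈ x.asHomogeneousIdeal
    · have h12 : i + 1 ≠ i + 2 := by fin_cases i <;> decide
      have hm : ∀ i, mono k (v i) ∈ AddMonoidAlgebra.gradeBy k Δ.degree N := fun i => by
        have := mono_mem (k := k) (v i)
        rwa [degree_lattice_vertex h hv i] at this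
      rcases hx (fraction (hm (i + 1)) (hm i) hi) (fraction (hm (i + 2)) (hm i) hi) with hd | hd
      · exact absurd hd (not_dvd_of_mem h hN hv h12 hi h1)
      · exact absurd hd (not_dvd_of_mem h hN hv h12.symm hi h2)
    · exact ⟨i, i + 2, by fin_cases i <;> decide, hi, h2⟩
  · exact ⟨i, i + 1, by fin_cases i <;> decide, hi, h1⟩

end Points
end RationalTriangle

namespace RationalTriangle
variable {k : Type u} [Field k] {Δ : RationalTriangle}

/-! ### A monomial that is locally a power -/

/-- Every lattice vector is the difference of two elements of the semigroup of the same degree. -/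
theorem exists_eq_add_vector (h : Δ.area ≠ 0) (m : ℤ × ℤ) :
    ∃ x y : Δ.semigroup, x.1 = y.1 + (0, m) := by
  obtain ⟨N, V, hN, hV⟩ := Δ.exists_lattice_multiple
  have hc := coord_lattice_vertex h hV
  have hN' : (1 : ℚ) ≤ N := by exact_mod_cast hN
  obtain ⟨n, hn⟩ := exists_nat_ge (∑ i, |Δ.coord i (0, m)|)
  have hy : ∀ i, Δ.coord i (n • ∑ j, (N, V j)) = n * N := fun i => by
    rw [map_nsmul, map_sum, nsmul_eq_mul]
    simp [hc]
  refine ⟨⟨n • (∑ j, (N, V j)) + (0, m), (mem_semigroup_iff h _).2 fun i => ?_⟩,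
    ⟨n • ∑ j, (N, V j), (mem_semigroup_iff h _).2 fun i => ?_⟩, rfl⟩
  · rw [map_add, hy]
    have h1 : |Δ.coord i (0, m)| ≤ ∑ i, |Δ.coord i (0, m)| :=
      Finset.single_le_sum (fun j _ => abs_nonneg (Δ.coord j (0, m))) (Finset.mem_univ i)
    have h2 := neg_abs_le (Δ.coord i (0, m))
    have h3 : (n : ℚ) * 1 ≤ n * N := mul_le_mul_of_nonneg_left hN' (Nat.cast_nonneg n)
    linarith
  · rw [hy]
    positivity

/-- The generic point of the toric surface. -/
noncomputable def genericPoint {N : ℕ} (hN : 0 < N) (v : Δ.semigroup) (hv : v.1.1 = N) :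
    ProjectiveSpectrum (AddMonoidAlgebra.gradeBy k Δ.degree) where
  asHomogeneousIdeal := ⊥
  isPrime := Ideal.isPrime_bot
  not_irrelevant_le := fun hle => by
    refine mono_ne_zero (k := k) v (hle ?_)
    refine (HomogeneousIdeal.mem_irrelevant_iff _ _).2 ?_
    rw [GradedRing.proj_apply]
    exact DirectSum.decompose_of_mem_ne _ (mono_mem v) (by rw [hv]; exact hN.ne')

/-- If the first basis vector is congruent modulo `g` to a multiple of a direction vector of the
edge between two vertices, then the monomial of the first basis vector is a `g`-th power up to a
unit at every point lying in the charts of both vertices. -/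
theorem exists_unit_mul_pow (h : Δ.area ≠ 0) {N : ℕ} {v : Fin 3 → Δ.semigroup}
    (hv : ∀ i j, Δ.coord i (v j) = if i = j then (N : ℚ) else 0) {g : ℕ}
    {ξ x : ProjectiveSpectrum (AddMonoidAlgebra.gradeBy k Δ.degree)} (hξ : ξ ≤ x)
    {i j : Fin 3} (hi : mono k (v i) ∉ x.asHomogeneousIdeal)
    (hj : mono k (v j) ∉ x.asHomogeneousIdeal)
    {e m : ℤ × ℤ} {K c : ℕ} (hK : 0 < K) (hij : (v i).1.2 = (v j).1.2 + K • e)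
    (hem : ((1, 0) : ℤ × ℤ) = c • e + g • m)
    {x₁ x₂ : Δ.semigroup} (hx : x₁.1 = x₂.1 + (0, (1, 0))) {d : ℕ}
    {h₁ : mono k x₁ ∈ AddMonoidAlgebra.gradeBy k Δ.degree d}
    {h₂ : mono k x₂ ∈ AddMonoidAlgebra.gradeBy k Δ.degree d}
    {h₂ξ : mono k x₂ ∉ ξ.asHomogeneousIdeal}
    (hbot : ∀ z : Δ.semigroup, mono k z ∉ ξ.asHomogeneousIdeal) :
    ∃ (u : LocalRingAt (AddMonoidAlgebra.gradeBy k Δ.degree) x)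
      (r : LocalRingAt (AddMonoidAlgebra.gradeBy k Δ.degree) ξ), IsUnit u ∧
      fraction h₁ h₂ h₂ξ = HomogeneousLocalization.mapId _ (primeCompl_le hξ) u * r ^ g := by
  have hdeg := degree_lattice_vertex h hv
  -- The lattice point next to `v j` on the edge towards `v i`.
  have hw : K • ((v j).1 + (0, e)) = (K - 1) • (v j).1 + (v i).1 := by
    obtain ⟨K, rfl⟩ := Nat.exists_eq_succ_of_ne_zero hK.ne'
    refine Prod.ext ?_ ?_
    · simp [hdeg, add_mul]
    · rw [Prod.snd_add, hij]
      simp [add_smul]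
      abel
  have hwmem : (v j : ℕ × (ℤ × ℤ)) + (0, e) ∈ Δ.semigroup := by
    rw [mem_semigroup_iff h]
    intro l
    have h1 := congrArg (Δ.coord l) hw
    rw [map_nsmul, map_add _ ((K - 1) • _), map_nsmul, nsmul_eq_mul, nsmul_eq_mul] at h1
    have h2 := coord_nonneg h (v j) l
    have h3 := coord_nonneg h (v i) l
    have h4 : 0 ≤ (K : ℚ) * Δ.coord l ((v j : ℕ × (ℤ × ℤ)) + (0, e)) := by
      rw [h1]; positivity
    exact nonneg_of_mul_nonneg_right h4 (by exact_mod_cast hK)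
  set w : Δ.semigroup := ⟨_, hwmem⟩ with hwdef
  have hw' : K • w = (K - 1) • v j + v i := Subtype.ext hw
  have hwx : mono k w ∉ x.asHomogeneousIdeal := fun hmem => by
    have h1 : mono k w ^ K ∈ x.asHomogeneousIdeal := Ideal.pow_mem_of_mem _ hmem K hK
    rw [← mono_nsmul, hw', mono_add, mono_nsmul] at h1
    exact mul_notMem (pow_notMem hj _) hi h1
  obtain ⟨y₁, y₂, hy⟩ := exists_eq_add_vector h m
  have hwN : mono k w ∈ AddMonoidAlgebra.gradeBy k Δ.degree (v j).1.1 := mono_mem w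
  have hyN : mono k y₁ ∈ AddMonoidAlgebra.gradeBy k Δ.degree y₂.1.1 := by
    have h1 := mono_mem (k := k) y₁
    rwa [show y₁.1.1 = y₂.1.1 by rw [hy]; rfl] at h1
  refine ⟨fraction hwN (mono_mem (v j)) hj ^ c, fraction hyN (mono_mem y₂) (hbot y₂),
    (isUnit_fraction hwx).pow c, ?_⟩
  rw [map_pow, mapId_fraction hξ, fraction_pow, fraction_pow, fraction_mul,
    fraction_eq_fraction_iff]
  simp only [← mono_nsmul, ← mono_add]
  congr 1
  apply Subtype.ext
  simp only [AddSubmonoid.coe_add, AddSubmonoidClass.coe_nsmul, hx, hy, hwdef]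
  rw [hem, smul_add, smul_add]
  have h1 : ((0, c • e + g • m) : ℕ × (ℤ × ℤ)) = c • (0, e) + g • (0, m) := by simp
  rw [h1]
  abel

/-- The degree of a monomial in the first variable, shifted by a multiple of the degree so as to be
nonnegative. -/
theorem exists_shifted_degree (h : Δ.area ≠ 0) :
    ∃ (ℓ : Δ.semigroup →+ ℕ) (C : ℕ), ∀ x, (ℓ x : ℤ) = x.1.2.1 + C * x.1.1 := by
  obtain ⟨C, hC⟩ := exists_nat_ge (∑ i, |(Δ.vertex i).1|)
  have hnn : ∀ x : Δ.semigroup, 0 ≤ x.1.2.1 + (C : ℤ) * x.1.1 := fun x => by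
    have h0 := sum_coord h (x : ℕ × (ℤ × ℤ))
    have h1 := sum_coord_mul_fst h (x : ℕ × (ℤ × ℤ))
    have h2 : 0 ≤ (x.1.2.1 + C * x.1.1 : ℚ) := by
      rw [← h0, ← h1, Finset.mul_sum, ← Finset.sum_add_distrib]
      refine Finset.sum_nonneg fun i _ => ?_
      rw [mul_comm (C : ℚ), ← mul_add]
      refine mul_nonneg (coord_nonneg h x i) ?_
      have h3 : |(Δ.vertex i).1| ≤ ∑ i, |(Δ.vertex i).1| :=
        Finset.single_le_sum (fun j _ => abs_nonneg (Δ.vertex j).1) (Finset.mem_univ i)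
      have := neg_abs_le (Δ.vertex i).1
      linarith
    exact_mod_cast h2
  refine ⟨⟨⟨fun x => (x.1.2.1 + (C : ℤ) * x.1.1).toNat, by simp⟩, fun x y => ?_⟩, C,
    fun x => Int.toNat_of_nonneg (hnn x)⟩
  change Int.toNat _ = Int.toNat _ + Int.toNat _
  rw [← Int.toNat_add (hnn x) (hnn y)]
  congr 1
  simp only [AddSubmonoid.coe_add, Prod.fst_add, Prod.snd_add, Nat.cast_add]
  ring

/-- The monomial of the first basis vector is not a `g`-th power of a rational function: compare
degrees in the first variable. -/
theorem fraction_ne_pow (h : Δ.area ≠ 0) {g : ℕ} (hg : 1 < g)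
    {ξ : ProjectiveSpectrum (AddMonoidAlgebra.gradeBy k Δ.degree)}
    {x₁ x₂ : Δ.semigroup} (hx : x₁.1 = x₂.1 + (0, (1, 0))) {d : ℕ}
    {h₁ : mono k x₁ ∈ AddMonoidAlgebra.gradeBy k Δ.degree d}
    {h₂ : mono k x₂ ∈ AddMonoidAlgebra.gradeBy k Δ.degree d}
    {h₂ξ : mono k x₂ ∉ ξ.asHomogeneousIdeal}
    (r : LocalRingAt (AddMonoidAlgebra.gradeBy k Δ.degree) ξ) :
    fraction h₁ h₂ h₂ξ ≠ r ^ g := by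
  intro hr
  obtain ⟨e, F, G, hF, hG, hGξ, rfl⟩ := exists_eq_fraction r
  rw [fraction_pow, fraction_eq_fraction_iff] at hr
  obtain ⟨ℓ, C, hℓ⟩ := exists_shifted_degree h
  have hG0 : G ≠ 0 := fun h0 => hGξ (h0 ▸ zero_mem _)
  have hL0 : mono k x₁ * G ^ g ≠ 0 := mul_ne_zero (mono_ne_zero x₁) (pow_ne_zero _ hG0)
  have hF0 : F ^ g ≠ 0 := left_ne_zero_of_mul (hr ▸ hL0)
  have inj : ∀ {a : AddMonoidAlgebra k Δ.semigroup}, a ≠ 0 →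
      toPolynomial (AddMonoidAlgebra.gradeBy k ℓ) a ≠ 0 := fun {a} ha h0 => ha <| by
    have h1 := eval_one_toPolynomial (𝒜 := AddMonoidAlgebra.gradeBy k ℓ) a
    rw [← h1, h0, Polynomial.eval_zero]
  have hdeg : ∀ x : Δ.semigroup,
      (toPolynomial (AddMonoidAlgebra.gradeBy k ℓ) (mono k x)).natDegree = ℓ x := fun x => by
    have h1 : mono k x ∈ AddMonoidAlgebra.gradeBy k ℓ (ℓ x) :=
      AddMonoidAlgebra.single_mem_gradeBy ℓ x 1
    rw [toPolynomial_of_mem h1]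
    exact Polynomial.natDegree_monomial_eq _ (mono_ne_zero x)
  have key := congrArg (fun a => (toPolynomial (AddMonoidAlgebra.gradeBy k ℓ) a).natDegree) hr
  simp only [map_mul] at key
  rw [Polynomial.natDegree_mul (inj (mono_ne_zero x₁)) (inj (pow_ne_zero _ hG0)),
    Polynomial.natDegree_mul (inj hF0) (inj (mono_ne_zero x₂)), hdeg, hdeg, map_pow, map_pow,
    Polynomial.natDegree_pow, Polynomial.natDegree_pow] at key
  have hℓ1 : ℓ x₁ = ℓ x₂ + 1 := by
    have e1 := hℓ x₁
    have e2 := hℓ x₂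
    rw [hx] at e1
    simp only [Prod.fst_add, Prod.snd_add, add_zero] at e1
    omega
  rw [hℓ1] at key
  have : g ∣ 1 := by
    refine (Nat.dvd_add_right (Dvd.intro ((toPolynomial (AddMonoidAlgebra.gradeBy k ℓ) G).natDegree)
      rfl)).1 (⟨(toPolynomial (AddMonoidAlgebra.gradeBy k ℓ) F).natDegree, ?_⟩ : g ∣ _ + 1)
    omega
  exact absurd (Nat.le_of_dvd one_pos this) (by omega)

/-- If the first basis vector is congruent modulo `g > 1` to a multiple of a direction vector of
every edge, then its monomial is locally a `g`-th power up to units, but not a `g`-th power. -/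
theorem not_powersAreLocal_toricSurface (h : Δ.area ≠ 0) {g : ℕ} (hg : 1 < g) {N : ℕ} (hN : 0 < N)
    {V : Fin 3 → ℤ × ℤ}
    (hV : ∀ i, ((V i).1 : ℚ) = N * (Δ.vertex i).1 ∧ ((V i).2 : ℚ) = N * (Δ.vertex i).2)
    (hedge : ∀ i j, i ≠ j → ∃ (e m : ℤ × ℤ) (K c : ℤ), K ≠ 0 ∧ V i = V j + K • e ∧
      ((1, 0) : ℤ × ℤ) = c • e + g • m) :
    ¬ PowersAreLocal g (toricSurface k Δ).left := by
  change ¬ PowersAreLocal g (Proj (AddMonoidAlgebra.gradeBy k Δ.degree))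
  rw [powersAreLocal_proj_iff]
  intro H
  have hc := coord_lattice_vertex h hV
  let v : Fin 3 → Δ.semigroup := fun j => ⟨(N, V j), (mem_semigroup_iff h _).2 fun i => by
    rw [hc]; split_ifs <;> positivity⟩
  have hv : ∀ i j, Δ.coord i (v j) = if i = j then (N : ℚ) else 0 := hc
  obtain ⟨x₁, x₂, hx⟩ := exists_eq_add_vector h (1, 0)
  let ξ := genericPoint (k := k) hN (v 0) rfl
  have hbot : ∀ z : Δ.semigroup, mono k z ∉ ξ.asHomogeneousIdeal := fun z => mono_ne_zero z
  have hle : ∀ x, ξ ≤ x := fun x => (bot_le : (⊥ : HomogeneousIdeal _) ≤ x.asHomogeneousIdeal)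
  have h₁ : mono k x₁ ∈ AddMonoidAlgebra.gradeBy k Δ.degree x₂.1.1 := by
    have h1 := mono_mem (k := k) x₁
    rwa [show x₁.1.1 = x₂.1.1 by rw [hx]; rfl] at h1
  obtain ⟨r, hr⟩ := H ξ hle (fraction h₁ (mono_mem x₂) (hbot x₂)) fun x hx' => by
    obtain ⟨i, j, hij, hi, hj⟩ := exists_two_vertices_notMem h hN hv hx'
    obtain ⟨e, m, K, c, hK, hV', hem⟩ := hedge i j hij
    -- Replacing `(e, K, c)` by its negative makes `K` positive, and `c` matters only modulo `g`.
    obtain ⟨e, K, c, hK, hV', hem⟩ : ∃ (e : ℤ × ℤ) (K : ℕ) (c : ℤ), 0 < K ∧ V i = V j + K • e ∧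
        ((1, 0) : ℤ × ℤ) = c • e + g • m := by
      rcases Int.natAbs_eq K with hK' | hK'
      · exact ⟨e, K.natAbs, c, Int.natAbs_pos.2 hK, by rw [hV', ← natCast_zsmul, ← hK'], hem⟩
      · refine ⟨-e, K.natAbs, -c, Int.natAbs_pos.2 hK, ?_, by rw [neg_smul_neg, hem]⟩
        rw [hV', ← natCast_zsmul, smul_neg, ← neg_smul, ← hK']
    refine exists_unit_mul_pow h hv (hle x) hi hj (c := (c + g * |c|).toNat) (m := m - |c| • e) hK
      hV' ?_ hx hbot
    have hc0 : 0 ≤ c + g * |c| := by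
      have := neg_abs_le c
      have : (1 : ℤ) * |c| ≤ g * |c| := mul_le_mul_of_nonneg_right (by omega) (abs_nonneg c)
      linarith
    rw [← natCast_zsmul, Int.toNat_of_nonneg hc0, hem, add_smul, mul_smul, smul_sub,
      natCast_zsmul]
    abel
  exact fraction_ne_pow h hg hx r hr

end RationalTriangle

/-! ### Veronese subrings -/

section Veronese

open HomogeneousLocalization

variable {k A B : Type u} [Field k] [CommRing A] [CommRing B] [Algebra k A] [Algebra k B]

/-- The homomorphism `φ` identifies the graded algebra `𝒜` with the `N`-th Veronese subring of `ℬ`,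
the elements of degree `d` corresponding to those of degree `N * d`. -/
structure IsVeronese (𝒜 : ℕ → Submodule k A) (ℬ : ℕ → Submodule k B) (N : ℕ) (φ : A →ₐ[k] B) :
    Prop where
  pos : 0 < N
  injective : Function.Injective φ
  map_mem : ∀ {d a}, a ∈ 𝒜 d → φ a ∈ ℬ (N * d)
  exists_eq : ∀ {d b}, b ∈ ℬ (N * d) → ∃ a ∈ 𝒜 d, φ a = b

/-- A point of `Proj` lies in the basic open of some homogeneous element of positive degree. -/
theorem exists_homogeneous_notMem {R σ : Type*} [CommRing R] [SetLike σ R] [AddSubgroupClass σ R]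
    (𝒞 : ℕ → σ) [GradedRing 𝒞] (x : ProjectiveSpectrum 𝒞) :
    ∃ (b : R) (e : ℕ), 0 < e ∧ b ∈ 𝒞 e ∧ b ∉ x.asHomogeneousIdeal := by
  by_contra! H
  refine x.not_irrelevant_le ((HomogeneousIdeal.toIdeal_irrelevant_le _).2 ?_)
  intro i hi b hb
  exact H b i hi hb

namespace IsVeronese

variable {𝒜 : ℕ → Submodule k A} {ℬ : ℕ → Submodule k B} [GradedAlgebra 𝒜] [GradedAlgebra ℬ]
  {N : ℕ} {φ : A →ₐ[k] B} (h : IsVeronese 𝒜 ℬ N φ)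

include h

/-- The map `(A_f)₀ → (B_{φ f})₀` induced by `φ`. -/
noncomputable def awayHom (f : A) : Away 𝒜 f →+* Away ℬ (φ f) where
  toFun := Quotient.map'
    (fun x => ⟨N * x.deg, ⟨φ x.num, h.map_mem x.num.2⟩, ⟨φ x.den, h.map_mem x.den.2⟩, by
      obtain ⟨n, hn⟩ := x.den_mem; exact ⟨n, by simp [← hn]⟩⟩)
    fun x y (e : Localization.mk _ _ = Localization.mk _ _) => by
      change Localization.mk _ _ = Localization.mk _ _
      rw [Localization.mk_eq_mk_iff, Localization.r_iff_exists] at e ⊢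
      obtain ⟨⟨_, n, rfl⟩, hc⟩ := e
      refine ⟨⟨φ f ^ n, n, rfl⟩, ?_⟩
      simpa using congrArg φ hc
  map_add' := Quotient.ind₂' fun x y => by
    apply val_injective
    refine (val_mk _).trans (Eq.trans ?_ (val_add _ _).symm)
    refine Eq.trans ?_ (Localization.add_mk _ _ _ _).symm
    rw [Localization.mk_eq_mk_iff, Localization.r_iff_exists]
    exact ⟨1, by simp⟩
  map_mul' := Quotient.ind₂' fun x y => by
    apply val_injective
    refine (val_mk _).trans (Eq.trans ?_ (val_mul _ _).symm)
    refine Eq.trans ?_ (Localization.mk_mul _ _ _ _).symm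
    rw [Localization.mk_eq_mk_iff, Localization.r_iff_exists]
    exact ⟨1, by simp⟩
  map_zero' := by
    apply val_injective
    refine (val_mk _).trans ?_
    rw [val_zero, ← Localization.mk_zero 1, Localization.mk_eq_mk_iff, Localization.r_iff_exists]
    exact ⟨1, by simp⟩
  map_one' := by
    apply val_injective
    refine (val_mk _).trans ?_
    rw [val_one, ← Localization.mk_one, Localization.mk_eq_mk_iff, Localization.r_iff_exists]
    exact ⟨1, by simp⟩

theorem awayHom_mk {f : A} {d : ℕ} (hf : f ∈ 𝒜 d) (n : ℕ) (a : A) (ha : a ∈ 𝒜 (n • d)) :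
    h.awayHom f (Away.mk 𝒜 hf n a ha) = Away.mk ℬ (h.map_mem hf) n (φ a)
      (by simpa [mul_left_comm] using h.map_mem ha) := by
  apply val_injective
  refine (val_mk _).trans ((Localization.mk_eq_mk_iff.2 ?_).trans (val_mk _).symm)
  rw [Localization.r_iff_exists]
  exact ⟨1, by simp⟩

theorem awayHom_bijective {f : A} {d : ℕ} (hf : f ∈ 𝒜 d) : Function.Bijective (h.awayHom f) := by
  constructor
  · rw [injective_iff_map_eq_zero]
    intro x hx
    obtain ⟨n, a, ha, rfl⟩ := Away.mk_surjective 𝒜 hf x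
    rw [awayHom_mk, HomogeneousLocalization.ext_iff_val, Away.val_mk, val_zero,
      ← Localization.mk_zero 1, Localization.mk_eq_mk_iff, Localization.r_iff_exists] at hx
    obtain ⟨⟨_, m, rfl⟩, hc⟩ := hx
    rw [HomogeneousLocalization.ext_iff_val, Away.val_mk, val_zero,
      ← Localization.mk_zero 1, Localization.mk_eq_mk_iff, Localization.r_iff_exists]
    refine ⟨⟨f ^ m, m, rfl⟩, h.injective ?_⟩
    simpa using hc
  · intro y
    obtain ⟨n, b, hb, rfl⟩ := Away.mk_surjective ℬ (h.map_mem hf) y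
    obtain ⟨a, ha, rfl⟩ := h.exists_eq (d := n • d) (by simpa [mul_left_comm] using hb)
    exact ⟨Away.mk 𝒜 hf n a ha, h.awayHom_mk hf n a ha⟩

/-- The isomorphism `(A_f)₀ ≃ (B_{φ f})₀` induced by `φ`, for `f` homogeneous. -/
noncomputable def awayEquiv {f : A} {d : ℕ} (hf : f ∈ 𝒜 d) : Away 𝒜 f ≃+* Away ℬ (φ f) :=
  RingEquiv.ofBijective (h.awayHom f) (h.awayHom_bijective hf)

theorem awayHom_awayMap {f g x : A} {d e : ℕ} (hf : f ∈ 𝒜 d) (hg : g ∈ 𝒜 e) (hx : x = f * g)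
    (hx' : φ x = φ f * φ g) (z : Away 𝒜 f) :
    h.awayHom x (awayMap 𝒜 hg hx z) = awayMap ℬ (h.map_mem hg) hx' (h.awayHom f z) := by
  obtain ⟨n, a, ha, rfl⟩ := Away.mk_surjective 𝒜 hf z
  rw [awayMap_mk, awayHom_mk, awayHom_mk, awayMap_mk, HomogeneousLocalization.ext_iff_val]
  simp

omit [GradedAlgebra 𝒜] in
theorem exists_notMem (x : Proj ℬ) :
    ∃ s : Σ i : PNat, 𝒜 i, φ s.2 ∉ x.asHomogeneousIdeal := by
  obtain ⟨b, e, he, hb, hbx⟩ := exists_homogeneous_notMem ℬ x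
  obtain ⟨a, ha, hab⟩ := h.exists_eq (d := e) (b := b ^ N)
    (by simpa using SetLike.pow_mem_graded N hb)
  refine ⟨⟨⟨e, he⟩, a, ha⟩, ?_⟩
  rw [hab]
  exact fun hmem => hbx (x.isPrime.mem_of_pow_mem N hmem)

/-- `Proj B` is covered by the basic opens of the elements `φ f`, since the `N`-th power of a
homogeneous element of `B` lies in the image of `φ`. -/
noncomputable def cover : (Proj ℬ).AffineOpenCover where
  I₀ := Σ i : PNat, 𝒜 i
  X s := .of (Away ℬ (φ s.2))
  f s := Proj.awayι ℬ (φ s.2) (h.map_mem s.2.2) (Nat.mul_pos h.pos s.1.pos)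
  idx x := (h.exists_notMem x).choose
  covers x := by
    change x ∈ (Proj.awayι ℬ _ _ _).opensRange
    rw [Proj.opensRange_awayι]
    exact (h.exists_notMem x).choose_spec

theorem specMap_comp {f g x : A} {d e : ℕ} (hf : f ∈ 𝒜 d) (hg : g ∈ 𝒜 e) (hx : x = f * g)
    (hx' : φ x = φ f * φ g) :
    Spec.map (CommRingCat.ofHom (awayMap ℬ (h.map_mem hg) hx')) ≫
      Spec.map (CommRingCat.ofHom (h.awayHom f)) =
    Spec.map (CommRingCat.ofHom (h.awayHom x)) ≫
      Spec.map (CommRingCat.ofHom (awayMap 𝒜 hg hx)) := by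
  rw [← Spec.map_comp, ← Spec.map_comp, ← CommRingCat.ofHom_comp, ← CommRingCat.ofHom_comp]
  congr 2
  ext z : 1
  exact (h.awayHom_awayMap hf hg hx hx' z).symm

theorem specMap_inv_comp {f g x : A} {d e m : ℕ} (hf : f ∈ 𝒜 d) (hg : g ∈ 𝒜 e) (hxm : x ∈ 𝒜 m)
    (hx : x = f * g) (hx' : φ x = φ f * φ g) :
    Spec.map (CommRingCat.ofHom (awayMap 𝒜 hg hx)) ≫
      Spec.map (CommRingCat.ofHom (h.awayEquiv hf).symm.toRingHom) =
    Spec.map (CommRingCat.ofHom (h.awayEquiv hxm).symm.toRingHom) ≫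
      Spec.map (CommRingCat.ofHom (awayMap ℬ (h.map_mem hg) hx')) := by
  rw [← Spec.map_comp, ← Spec.map_comp, ← CommRingCat.ofHom_comp, ← CommRingCat.ofHom_comp]
  congr 2
  ext z : 1
  obtain ⟨z, rfl⟩ := (h.awayEquiv hf).surjective z
  apply (h.awayEquiv hxm).injective
  simp only [RingEquiv.toRingHom_eq_coe, RingHom.coe_comp, RingHom.coe_coe, Function.comp_apply,
    RingEquiv.symm_apply_apply, RingEquiv.apply_symm_apply]
  exact h.awayHom_awayMap hf hg hx hx' z

/-- The chart of `Proj B` defined by `φ f`, for `f ∈ A` homogeneous of positive degree. -/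
noncomputable abbrev chart (s : Σ i : PNat, 𝒜 i) : Spec (.of (Away ℬ (φ s.2))) ⟶ Proj ℬ :=
  Proj.awayι ℬ (φ s.2) (h.map_mem s.2.2) (Nat.mul_pos h.pos s.1.pos)

/-- The morphisms from the charts of `Proj B` to `Proj A` agree on overlaps. -/
theorem specMap_awayHom_compatible (s t : Σ i : PNat, 𝒜 i) :
    Limits.pullback.fst (h.chart s) (h.chart t) ≫
      Spec.map (CommRingCat.ofHom (h.awayHom s.2.1)) ≫ Proj.awayι 𝒜 s.2.1 s.2.2 s.1.pos =
    Limits.pullback.snd (h.chart s) (h.chart t) ≫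
      Spec.map (CommRingCat.ofHom (h.awayHom t.2.1)) ≫ Proj.awayι 𝒜 t.2.1 t.2.2 t.1.pos := by
  have hst : φ (s.2.1 * t.2.1) = φ s.2.1 * φ t.2.1 := map_mul _ _ _
  rw [← cancel_epi (Proj.pullbackAwayιIso ℬ (h.map_mem s.2.2) (Nat.mul_pos h.pos s.1.pos)
    (h.map_mem t.2.2) (Nat.mul_pos h.pos t.1.pos) hst).inv, Proj.pullbackAwayιIso_inv_fst_assoc,
    Proj.pullbackAwayιIso_inv_snd_assoc, ← Category.assoc, ← Category.assoc,
    h.specMap_comp s.2.2 t.2.2 rfl hst, h.specMap_comp t.2.2 s.2.2 (mul_comm s.2.1 t.2.1)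
      (hst.trans (mul_comm _ _)), Category.assoc, Category.assoc, Proj.SpecMap_awayMap_awayι,
    Proj.SpecMap_awayMap_awayι]
  rfl

/-- The morphisms from the charts of `Proj A` to `Proj B` agree on overlaps. -/
theorem specMap_awayEquiv_symm_compatible (s t : Σ i : PNat, 𝒜 i) :
    Limits.pullback.fst (Proj.awayι 𝒜 s.2.1 s.2.2 s.1.pos) (Proj.awayι 𝒜 t.2.1 t.2.2 t.1.pos) ≫
      Spec.map (CommRingCat.ofHom (h.awayEquiv s.2.2).symm.toRingHom) ≫ h.chart s =
    Limits.pullback.snd (Proj.awayι 𝒜 s.2.1 s.2.2 s.1.pos) (Proj.awayι 𝒜 t.2.1 t.2.2 t.1.pos) ≫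
      Spec.map (CommRingCat.ofHom (h.awayEquiv t.2.2).symm.toRingHom) ≫ h.chart t := by
  have hst : φ (s.2.1 * t.2.1) = φ s.2.1 * φ t.2.1 := map_mul _ _ _
  have hm := SetLike.mul_mem_graded s.2.2 t.2.2
  rw [← cancel_epi (Proj.pullbackAwayιIso 𝒜 s.2.2 s.1.pos t.2.2 t.1.pos rfl).inv,
    Proj.pullbackAwayιIso_inv_fst_assoc, Proj.pullbackAwayιIso_inv_snd_assoc,
    ← Category.assoc, ← Category.assoc, h.specMap_inv_comp s.2.2 t.2.2 hm rfl hst,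
    h.specMap_inv_comp t.2.2 s.2.2 hm (mul_comm s.2.1 t.2.1) (hst.trans (mul_comm _ _)),
    Category.assoc, Category.assoc, Proj.SpecMap_awayMap_awayι, Proj.SpecMap_awayMap_awayι]
  rfl

/-- The morphism `Proj B ⟶ Proj A`, glued from the isomorphisms `(A_f)₀ ≃ (B_{φ f})₀`. -/
noncomputable def projHom : Proj ℬ ⟶ Proj 𝒜 :=
  h.cover.openCover.glueMorphisms _ h.specMap_awayHom_compatible

/-- The inverse of `projHom`. -/
noncomputable def projInv : Proj 𝒜 ⟶ Proj ℬ :=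
  (Proj.affineOpenCover 𝒜).openCover.glueMorphisms _ h.specMap_awayEquiv_symm_compatible

theorem chart_projHom (s : Σ i : PNat, 𝒜 i) :
    h.chart s ≫ h.projHom =
      Spec.map (CommRingCat.ofHom (h.awayHom s.2.1)) ≫ Proj.awayι 𝒜 s.2.1 s.2.2 s.1.pos :=
  h.cover.openCover.ι_glueMorphisms _ h.specMap_awayHom_compatible s

theorem awayι_projInv (s : Σ i : PNat, 𝒜 i) :
    Proj.awayι 𝒜 s.2.1 s.2.2 s.1.pos ≫ h.projInv =
      Spec.map (CommRingCat.ofHom (h.awayEquiv s.2.2).symm.toRingHom) ≫ h.chart s :=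
  (Proj.affineOpenCover 𝒜).openCover.ι_glueMorphisms _ h.specMap_awayEquiv_symm_compatible s

omit [GradedAlgebra 𝒜] in
theorem hom_ext_chart {Y : Scheme.{u}} {f g : Proj ℬ ⟶ Y}
    (hfg : ∀ s : Σ i : PNat, 𝒜 i, h.chart s ≫ f = h.chart s ≫ g) : f = g :=
  h.cover.openCover.hom_ext _ _ hfg

/-- `Proj` of a graded ring is isomorphic to `Proj` of its Veronese subring. -/
noncomputable def projIso : Proj ℬ ≅ Proj 𝒜 where
  hom := h.projHom
  inv := h.projInv
  hom_inv_id := h.hom_ext_chart fun s => by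
    have : (h.awayHom s.2.1).comp (h.awayEquiv s.2.2).symm.toRingHom = RingHom.id _ := by
      ext z : 1
      exact (h.awayEquiv s.2.2).apply_symm_apply z
    rw [← Category.assoc, h.chart_projHom s, Category.assoc, h.awayι_projInv s, ← Category.assoc,
      ← Spec.map_comp, ← CommRingCat.ofHom_comp, Category.comp_id, this, CommRingCat.ofHom_id,
      Spec.map_id, Category.id_comp]
  inv_hom_id := (Proj.affineOpenCover 𝒜).openCover.hom_ext _ _
    fun (s : Σ i : PNat, 𝒜 i) => by
    change Proj.awayι 𝒜 s.2.1 s.2.2 s.1.pos ≫ _ = Proj.awayι 𝒜 s.2.1 s.2.2 s.1.pos ≫ _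
    have : (h.awayEquiv s.2.2).symm.toRingHom.comp (h.awayHom s.2.1) = RingHom.id _ := by
      ext z : 1
      exact (h.awayEquiv s.2.2).symm_apply_apply z
    rw [← Category.assoc, h.awayι_projInv s, Category.assoc, h.chart_projHom s, ← Category.assoc,
      ← Spec.map_comp, ← CommRingCat.ofHom_comp, Category.comp_id, this, CommRingCat.ofHom_id,
      Spec.map_id, Category.id_comp]

/-- The isomorphism of `projIso`, over the base field. -/
noncomputable def projOverIso : projOver k ℬ ≅ projOver k 𝒜 :=
  Over.isoMk h.projIso <| h.hom_ext_chart fun s => by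
    change h.chart s ≫ h.projHom ≫ Proj.toSpecZero 𝒜 ≫ _ = h.chart s ≫ Proj.toSpecZero ℬ ≫ _
    rw [← Category.assoc, h.chart_projHom s, Category.assoc, Proj.awayι_toSpecZero_assoc,
      Proj.awayι_toSpecZero_assoc, ← Spec.map_comp, ← Spec.map_comp, ← Spec.map_comp,
      ← CommRingCat.ofHom_comp, ← CommRingCat.ofHom_comp, ← CommRingCat.ofHom_comp]
    congr 2
    ext c : 1
    apply val_injective
    refine (val_mk _).trans ((Localization.mk_eq_mk_iff.2 ?_).trans (val_mk _).symm)
    rw [Localization.r_iff_exists]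
    exact ⟨1, by simp⟩

end IsVeronese
end Veronese

/-! ### Veronese subrings of monoid algebras -/

section MonoidAlgebra

variable {k : Type u} [Field k] {P Q : Type} [AddCommMonoid P] [AddCommMonoid Q]

/-- An injective homomorphism of graded monoids onto the elements of degree divisible by `N`
identifies a monoid algebra with a Veronese subring. -/
theorem isVeronese_mapDomainAlgHom (degP : P →+ ℕ) (degQ : Q →+ ℕ) (ι : P →+ Q) {N : ℕ}
    (hN : 0 < N) (hι : Function.Injective ι) (hdeg : ∀ p, degQ (ι p) = N * degP p)
    (hsurj : ∀ d q, degQ q = N * d → ∃ p, ι p = q) :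
    IsVeronese (AddMonoidAlgebra.gradeBy k degP) (AddMonoidAlgebra.gradeBy k degQ) N
      (AddMonoidAlgebra.mapDomainAlgHom k k ι) where
  pos := hN
  injective := AddMonoidAlgebra.mapDomain_injective hι
  map_mem {d a} ha := by
    rw [← AddMonoidAlgebra.sum_coeff_single a, Finsupp.sum, map_sum]
    refine sum_mem fun z hz => ?_
    have hzd : degP z = d := ha z hz
    have h1 : AddMonoidAlgebra.mapDomainAlgHom k k ι (AddMonoidAlgebra.single z (a.coeff z)) =
        AddMonoidAlgebra.single (ι z) (a.coeff z) := AddMonoidAlgebra.mapDomain_single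
    rw [h1, ← hzd, ← hdeg]
    exact AddMonoidAlgebra.single_mem_gradeBy degQ (ι z) _
  exists_eq {d b} hb := by
    suffices b ∈ (AddMonoidAlgebra.gradeBy k degP d).map
      (AddMonoidAlgebra.mapDomainAlgHom k k ι).toLinearMap from this
    rw [← AddMonoidAlgebra.sum_coeff_single b, Finsupp.sum]
    refine sum_mem fun z hz => ?_
    have hzd : degQ z = N * d := hb z hz
    obtain ⟨p, rfl⟩ := hsurj d z hzd
    rw [hdeg] at hzd
    refine ⟨AddMonoidAlgebra.single p (b.coeff (ι p)), ?_, ?_⟩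
    · rw [← Nat.eq_of_mul_eq_mul_left hN hzd]
      exact AddMonoidAlgebra.single_mem_gradeBy degP p _
    · exact AddMonoidAlgebra.mapDomain_single

theorem weightedHomogeneousSubmodule_eq_gradeBy {σ : Type*} (w : σ → ℕ) :
    MvPolynomial.weightedHomogeneousSubmodule k w =
      AddMonoidAlgebra.gradeBy k (Finsupp.weight w) := by
  ext d a
  rw [MvPolynomial.weightedHomogeneousSubmodule_eq_finsupp_supported]
  rfl

end MonoidAlgebra

namespace RationalTriangle

/-- Suppose that a multiple of the triangle is cut out by three integral linear forms `L i`, which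
on the slice of degree `d` take exactly once each triple of natural values with
`∑ i, L i (d, m) * w i = D * d`. Then the toric surface is the weighted projective plane with
weights `w`: the forms identify the semigroup of that multiple with the submonoid of `ℕ³` of
elements of weight divisible by `D`, so the two graded algebras share a Veronese subring. -/
theorem nonempty_iso_weightedProjectivePlane {k : Type u} [Field k] {Δ : RationalTriangle}
    {w : Fin 3 → ℕ} {N D : ℕ} (hN : 0 < N) (hD : 0 < D) (L : Fin 3 → ℕ × (ℤ × ℤ) →+ ℤ)
    (hmem : ∀ d m, (N * d, m) ∈ Δ.semigroup ↔ ∀ i, 0 ≤ L i (d, m))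
    (hsum : ∀ x, ∑ i, L i x * w i = D * x.1)
    (hinj : ∀ d m m', (∀ i, L i (d, m) = L i (d, m')) → m = m')
    (hsurj : ∀ (d : ℕ) (n : Fin 3 → ℕ), ∑ i, n i * w i = D * d → ∃ m, ∀ i, L i (d, m) = n i) :
    Nonempty (toricSurface k Δ ≅ weightedProjectivePlane k w) := by
  let := MvPolynomial.weightedGradedAlgebra k w
  let T : AddSubmonoid (ℕ × (ℤ × ℤ)) :=
    { carrier := {x | ∀ i, 0 ≤ L i x}
      zero_mem' := fun i => (map_zero (L i)).ge
      add_mem' := fun hx hy i => by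
        rw [map_add]
        exact add_nonneg (hx i) (hy i) }
  let degT : T →+ ℕ := (AddMonoidHom.fst ℕ (ℤ × ℤ)).comp T.subtype
  let ι : T →+ Δ.semigroup :=
    { toFun x := ⟨(N * x.1.1, x.1.2), (hmem _ _).2 x.2⟩
      map_zero' := rfl
      map_add' x y := Subtype.ext (Prod.ext (mul_add _ _ _) rfl) }
  let κ : T →+ (Fin 3 →₀ ℕ) :=
    { toFun x := Finsupp.equivFunOnFinite.symm fun i => (L i x).toNat
      map_zero' := by ext i; simp
      map_add' x y := by
        ext i
        simp [Int.toNat_add (x.2 i) (y.2 i)] }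
  have hκ : ∀ x i, (κ x i : ℤ) = L i x := fun x i => Int.toNat_of_nonneg (x.2 i)
  have hκdeg : ∀ x, Finsupp.weight w (κ x) = D * degT x := fun x => by
    rw [Finsupp.weight_eq_sum]
    have := hsum x
    simp only [← hκ] at this
    exact_mod_cast this
  have h₁ : IsVeronese (AddMonoidAlgebra.gradeBy k degT) (AddMonoidAlgebra.gradeBy k Δ.degree) N
      (AddMonoidAlgebra.mapDomainAlgHom k k ι) := by
    refine isVeronese_mapDomainAlgHom degT Δ.degree ι hN ?_ (fun _ => rfl) ?_
    · rintro ⟨⟨d, m⟩, hx⟩ ⟨⟨d', m'⟩, hx'⟩ hxy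
      have h1 := congrArg Subtype.val hxy
      have h2 : N * d = N * d' := congrArg Prod.fst h1
      have h3 : m = m' := congrArg Prod.snd h1
      obtain rfl := Nat.eq_of_mul_eq_mul_left hN h2
      subst h3
      rfl
    · rintro d ⟨⟨e, m⟩, hx⟩ (rfl : e = N * d)
      exact ⟨⟨(d, m), (hmem _ _).1 hx⟩, rfl⟩
  have h₂ : IsVeronese (AddMonoidAlgebra.gradeBy k degT)
      (MvPolynomial.weightedHomogeneousSubmodule k w) D
      (AddMonoidAlgebra.mapDomainAlgHom k k κ) := by
    rw [weightedHomogeneousSubmodule_eq_gradeBy]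
    refine isVeronese_mapDomainAlgHom degT (Finsupp.weight w) κ hD ?_ hκdeg ?_
    · rintro ⟨⟨d, m⟩, hx⟩ ⟨⟨d', m'⟩, hx'⟩ hxy
      have h1 : D * d = D * d' :=
        (hκdeg ⟨_, hx⟩).symm.trans ((congrArg _ hxy).trans (hκdeg ⟨_, hx'⟩))
      obtain rfl := Nat.eq_of_mul_eq_mul_left hD h1
      obtain rfl := hinj d m m' fun i => by
        have h2 := hκ ⟨_, hx⟩ i
        rw [hxy] at h2
        exact h2.symm.trans (hκ ⟨_, hx'⟩ i)
      rfl
    · intro d n hn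
      rw [Finsupp.weight_eq_sum] at hn
      obtain ⟨m, hm⟩ := hsurj d n hn
      have hx : (d, m) ∈ T := fun i => by rw [hm]; exact Int.natCast_nonneg _
      refine ⟨⟨(d, m), hx⟩, ?_⟩
      ext i
      exact_mod_cast (hκ ⟨_, hx⟩ i).trans (hm i)
  exact ⟨h₁.projOverIso ≪≫ h₂.projOverIso.symm⟩

/-! ### Slopes of the edges -/

variable {Δ : RationalTriangle} {a p b q N : ℕ} {V : Fin 3 → ℤ × ℤ}

/-- For integral vertices `V i` of a multiple of the triangle, the form of the edge vectors for a
horizontal edge and two edges of slopes `a / p` and `b / q`. -/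
structure EdgeEquations (a p b q : ℕ) (V : Fin 3 → ℤ × ℤ) : Prop where
  base_ne : (V 1).1 ≠ (V 0).1
  height_ne : (V 2).2 ≠ (V 0).2
  horizontal : (V 1).2 = (V 0).2
  left : (p : ℤ) * ((V 2).2 - (V 0).2) = a * ((V 2).1 - (V 0).1)
  right : (q : ℤ) * ((V 2).2 - (V 0).2) = b * ((V 2).1 - (V 1).1)

theorem edgeEquations_of_hasSlope (ha : 0 < a) (hp : 0 < p) (hq : 0 < q) (hN : 0 < N)
    (hV : ∀ i, ((V i).1 : ℚ) = N * (Δ.vertex i).1 ∧ ((V i).2 : ℚ) = N * (Δ.vertex i).2)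
    (h_base : HasSlope (Δ.vertex 0) (Δ.vertex 1) 0)
    (h_s : HasSlope (Δ.vertex 0) (Δ.vertex 2) (a / p))
    (h_t : HasSlope (Δ.vertex 1) (Δ.vertex 2) (b / q)) : EdgeEquations a p b q V := by
  obtain ⟨h1, h2⟩ := h_base
  obtain ⟨h3, h4⟩ := h_s
  obtain ⟨h5, h6⟩ := h_t
  have hN' : (N : ℚ) ≠ 0 := by exact_mod_cast hN.ne'
  have hp' : (p : ℚ) ≠ 0 := by exact_mod_cast hp.ne'
  have hq' : (q : ℚ) ≠ 0 := by exact_mod_cast hq.ne'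
  have ha' : (a : ℚ) ≠ 0 := by exact_mod_cast ha.ne'
  rw [div_eq_iff (sub_ne_zero.2 h1.symm), zero_mul, sub_eq_zero] at h2
  rw [div_eq_iff (sub_ne_zero.2 h3.symm), div_mul_eq_mul_div, eq_div_iff hp'] at h4
  rw [div_eq_iff (sub_ne_zero.2 h5.symm), div_mul_eq_mul_div, eq_div_iff hq'] at h6
  have hv : (Δ.vertex 2).2 ≠ (Δ.vertex 0).2 := fun h => by
    rw [h, sub_self, zero_mul] at h4
    exact mul_ne_zero ha' (sub_ne_zero.2 h3.symm) h4.symm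
  refine ⟨fun h => h1 ?_, fun h => hv ?_, ?_, ?_, ?_⟩
  · have : ((V 1).1 : ℚ) = (V 0).1 := by exact_mod_cast h
    rw [(hV 1).1, (hV 0).1] at this
    exact (mul_left_cancel₀ hN' this).symm
  · have : ((V 2).2 : ℚ) = (V 0).2 := by exact_mod_cast h
    rw [(hV 2).2, (hV 0).2] at this
    exact mul_left_cancel₀ hN' this
  · have : ((V 1).2 : ℚ) = (V 0).2 := by rw [(hV 1).2, (hV 0).2, h2]
    exact_mod_cast this
  · have : (p : ℚ) * ((V 2).2 - (V 0).2) = a * ((V 2).1 - (V 0).1) := by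
      rw [(hV 2).2, (hV 0).2, (hV 2).1, (hV 0).1]
      linear_combination N * h4
    exact_mod_cast this
  · have : (q : ℚ) * ((V 2).2 - (V 0).2) = b * ((V 2).1 - (V 1).1) := by
      rw [(hV 2).2, (hV 0).2, (hV 2).1, (hV 1).1]
      rw [h2] at h6
      linear_combination N * h6
    exact_mod_cast this

theorem EdgeEquations.area_ne_zero (hV : ∀ i, ((V i).1 : ℚ) = N * (Δ.vertex i).1 ∧
      ((V i).2 : ℚ) = N * (Δ.vertex i).2) (E : EdgeEquations a p b q V) : Δ.area ≠ 0 := by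
  have h1 : ((V 1).1 - (V 0).1 : ℚ) * ((V 2).2 - (V 0).2) ≠ 0 :=
    mul_ne_zero (sub_ne_zero.2 (by exact_mod_cast E.base_ne))
      (sub_ne_zero.2 (by exact_mod_cast E.height_ne))
  have h2 : ((V 1).2 : ℚ) = (V 0).2 := by exact_mod_cast E.horizontal
  intro h
  apply h1
  rw [area] at h
  simp only [(hV _).1, (hV _).2] at h2 ⊢
  linear_combination (N : ℚ) ^ 2 * h + (N : ℚ) * ((Δ.vertex 2).1 - (Δ.vertex 0).1) * h2

/-- A vector of slope `a / p`, in lowest terms, is a multiple of `(p, a)`; and modulo a divisor of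
`a` the first basis vector is a multiple of `(p, a)`. -/
theorem exists_edge_direction {g : ℕ} (hp : 0 < p) (hap : a.Coprime p) (hga : g ∣ a) {U W : ℤ × ℤ}
    (hUW : U.2 ≠ W.2) (h : (p : ℤ) * (U.2 - W.2) = a * (U.1 - W.1)) :
    ∃ (e m : ℤ × ℤ) (K c : ℤ), K ≠ 0 ∧ U = W + K • e ∧ ((1, 0) : ℤ × ℤ) = c • e + g • m := by
  obtain ⟨β, α, hαβ⟩ := Nat.isCoprime_iff_coprime.2 hap
  obtain ⟨K, hK⟩ : (p : ℤ) ∣ U.1 - W.1 :=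
    (Nat.isCoprime_iff_coprime.2 hap.symm).dvd_of_dvd_mul_left ⟨_, h.symm⟩
  obtain ⟨r, rfl⟩ := hga
  have hK' : U.2 - W.2 = (g * r : ℕ) * K := by
    apply mul_left_cancel₀ (show (p : ℤ) ≠ 0 by exact_mod_cast hp.ne')
    rw [h, hK]; ring
  refine ⟨(p, (g * r : ℕ)), (β * r, -(α * r)), K, α, ?_, Prod.ext ?_ ?_, Prod.ext ?_ ?_⟩
  · rintro rfl
    exact hUW (by linarith)
  · simp; linarith
  · push_cast at hK'
    simp; linarith
  · push_cast at hαβ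
    simp; linarith
  · simp; ring

/-- If `g` divides both `a` and `b`, then the first basis vector is congruent modulo `g` to a
multiple of a direction vector of each edge. -/
theorem EdgeEquations.exists_direction (E : EdgeEquations a p b q V) {g : ℕ} (hp : 0 < p)
    (hq : 0 < q) (hap : a.Coprime p) (hbq : b.Coprime q) (hga : g ∣ a) (hgb : g ∣ b) (i j : Fin 3)
    (hij : i ≠ j) : ∃ (e m : ℤ × ℤ) (K c : ℤ), K ≠ 0 ∧ V i = V j + K • e ∧
      ((1, 0) : ℤ × ℤ) = c • e + g • m := by
  have symm : ∀ {U W : ℤ × ℤ}, (∃ (e m : ℤ × ℤ) (K c : ℤ), K ≠ 0 ∧ U = W + K • e ∧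
      ((1, 0) : ℤ × ℤ) = c • e + g • m) → ∃ (e m : ℤ × ℤ) (K c : ℤ), K ≠ 0 ∧ W = U + K • e ∧
      ((1, 0) : ℤ × ℤ) = c • e + g • m := by
    rintro U W ⟨e, m, K, c, hK, h, h'⟩
    exact ⟨e, m, -K, c, neg_ne_zero.2 hK, by rw [h, neg_smul, add_neg_cancel_right], h'⟩
  have h10 : ∃ (e m : ℤ × ℤ) (K c : ℤ), K ≠ 0 ∧ V 1 = V 0 + K • e ∧
      ((1, 0) : ℤ × ℤ) = c • e + g • m :=
    ⟨(1, 0), 0, (V 1).1 - (V 0).1, 1, sub_ne_zero.2 E.base_ne,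
      Prod.ext (by simp) (by simp [E.horizontal]), by simp⟩
  have h20 := exists_edge_direction hp hap hga E.height_ne E.left
  have h21 := exists_edge_direction hq hbq hgb (E.horizontal ▸ E.height_ne)
    (E.horizontal ▸ E.right)
  fin_cases i <;> fin_cases j <;> first | exact absurd rfl hij | skip
  exacts [symm h10, symm h20, h10, symm h21, h20, h21]

/-- The integral linear form `α m₁ + β m₂ + γ d` on pairs `(d, m)`. -/
def linearForm (α β γ : ℤ) : ℕ × (ℤ × ℤ) →+ ℤ where
  toFun x := α * x.2.1 + β * x.2.2 + γ * x.1
  map_zero' := by simp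
  map_add' x y := by simp; ring

theorem linearForm_apply (α β γ : ℤ) (x : ℕ × (ℤ × ℤ)) :
    linearForm α β γ x = α * x.2.1 + β * x.2.2 + γ * x.1 := rfl

/-- When `a` and `b` are coprime, the three primitive integral equations of the edges satisfy the
relation defining `ℙ(a, b, bp - aq)` and no other. -/
theorem nonempty_iso_of_coprime {k : Type u} [Field k] (hN : 0 < N)
    (hV : ∀ i, ((V i).1 : ℚ) = N * (Δ.vertex i).1 ∧ ((V i).2 : ℚ) = N * (Δ.vertex i).2)
    (E : EdgeEquations a p b q V) (ha : 0 < a) (hb : 0 < b)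
    (hlt : a * q < b * p) (hab : a.Coprime b) :
    Nonempty (toricSurface k Δ ≅ weightedProjectivePlane k ![a, b, b * p - a * q]) := by
  obtain ⟨α, β, hαβ⟩ := Nat.isCoprime_iff_coprime.2 hab
  have harea := E.area_ne_zero hV
  obtain ⟨hbase, hheight, hY, hl, hr⟩ := E
  set X0 := (V 0).1 with hX0
  set X1 := (V 1).1 with hX1
  set Y0 := (V 0).2 with hY0
  set H := (V 2).2 - Y0 with hH
  have hH0 : H ≠ 0 := sub_ne_zero.2 hheight
  have hbaseH : (a * b : ℤ) * (X1 - X0) = (b * p - a * q) * H := by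
    linear_combination a * hr - b * hl
  -- The sign of the height makes the three forms nonnegative on the triangle.
  obtain ⟨ε, hε, hεH⟩ : ∃ ε : ℤ, ε * ε = 1 ∧ 0 < ε * H := by
    rcases lt_or_gt_of_ne hH0 with h | h
    · exact ⟨-1, by norm_num, by linarith⟩
    · exact ⟨1, by norm_num, by linarith⟩
  have hw : (((b * p - a * q : ℕ) : ℤ)) = b * p - a * q := by
    rw [Nat.cast_sub hlt.le]; push_cast; ring
  have hwpos : (0 : ℤ) < b * p - a * q := by rw [← hw]; exact_mod_cast Nat.sub_pos_of_lt hlt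
  have ha' : (0 : ℤ) < a := by exact_mod_cast ha
  have hb' : (0 : ℤ) < b := by exact_mod_cast hb
  obtain ⟨D, hD⟩ : ∃ D : ℕ, (b * p - a * q : ℤ) * (ε * H) = D :=
    Int.eq_ofNat_of_zero_le (mul_pos hwpos hεH).le
  have hD0 : 0 < D := by
    have := mul_pos hwpos hεH
    rw [hD] at this; exact_mod_cast this
  have hεbase : 0 < ε * (X1 - X0) := by
    have h1 : 0 < (a * b : ℤ) * (ε * (X1 - X0)) := by
      have := mul_pos hwpos hεH
      linarith [congrArg (ε * ·) hbaseH]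
    exact pos_of_mul_pos_right h1 (by positivity)
  let L : Fin 3 → ℕ × (ℤ × ℤ) →+ ℤ :=
    ![linearForm (-ε * b) (ε * q) (ε * (b * X1 - q * Y0)),
      linearForm (ε * a) (-ε * p) (ε * (p * Y0 - a * X0)), linearForm 0 ε (-ε * Y0)]
  have hL0 : ∀ x, L 0 x = ε * (-(b * (x.2.1 - x.1 * X1)) + q * (x.2.2 - x.1 * Y0)) := fun x => by
    change linearForm _ _ _ x = _
    rw [linearForm_apply]; ring
  have hL1 : ∀ x, L 1 x = ε * (a * (x.2.1 - x.1 * X0) - p * (x.2.2 - x.1 * Y0)) := fun x => by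
    change linearForm _ _ _ x = _
    rw [linearForm_apply]; ring
  have hL2 : ∀ x, L 2 x = ε * (x.2.2 - x.1 * Y0) := fun x => by
    change linearForm _ _ _ x = _
    rw [linearForm_apply]; ring
  have hsum : ∀ x, ∑ i, L i x * (![a, b, b * p - a * q] i : ℕ) = (D : ℤ) * x.1 := fun x => by
    rw [Fin.sum_univ_three, hL0, hL1, hL2]
    simp only [Matrix.cons_val]
    rw [hw]
    linear_combination ε * x.1 * hbaseH + x.1 * hD
  refine nonempty_iso_weightedProjectivePlane hN hD0 L ?_ hsum ?_ ?_
  · intro d m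
    have hN' : (0 : ℚ) < N := by exact_mod_cast hN
    have hX0' : (X0 : ℚ) = N * (Δ.vertex 0).1 := (hV 0).1
    have hX1' : (X1 : ℚ) = N * (Δ.vertex 1).1 := (hV 1).1
    have hY0' : (Y0 : ℚ) = N * (Δ.vertex 0).2 := (hV 0).2
    have hH' : (H : ℚ) = N * ((Δ.vertex 2).2 - (Δ.vertex 0).2) := by
      rw [hH, Int.cast_sub, hY0', (hV 2).2]; ring
    have hy : (Δ.vertex 1).2 = (Δ.vertex 0).2 := by
      apply mul_left_cancel₀ hN'.ne'
      rw [← (hV 1).2, ← hY0', hY]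
    have hl' : (p : ℚ) * ((Δ.vertex 2).2 - (Δ.vertex 0).2) =
        a * ((Δ.vertex 2).1 - (Δ.vertex 0).1) := by
      apply mul_left_cancel₀ hN'.ne'
      have := congrArg (Int.cast : ℤ → ℚ) hl
      push_cast at this
      rw [hH', hX0', (hV 2).1] at this
      linear_combination this
    have hr' : (q : ℚ) * ((Δ.vertex 2).2 - (Δ.vertex 0).2) =
        b * ((Δ.vertex 2).1 - (Δ.vertex 1).1) := by
      apply mul_left_cancel₀ hN'.ne'
      have := congrArg (Int.cast : ℤ → ℚ) hr
      push_cast at this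
      rw [hH', hX1', (hV 2).1] at this
      linear_combination this
    have h0 : (L 0 (d, m) : ℚ) = (b * (ε * ((Δ.vertex 1).1 - (Δ.vertex 0).1))) *
        Δ.coord 0 (N * d, m) := by
      rw [hL0, coord_apply, mul_div_assoc', eq_div_iff harea, area]
      push_cast
      rw [hX1', hY0', hy]
      linear_combination ε * ((Δ.vertex 1).1 - (Δ.vertex 0).1) *
        (m.2 - d * (N * (Δ.vertex 0).2)) * hr'
    have h1 : (L 1 (d, m) : ℚ) = (a * (ε * ((Δ.vertex 1).1 - (Δ.vertex 0).1))) *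
        Δ.coord 1 (N * d, m) := by
      rw [hL1, coord_apply, mul_div_assoc', eq_div_iff harea, area]
      push_cast
      rw [hX0', hY0', hy]
      linear_combination -ε * ((Δ.vertex 1).1 - (Δ.vertex 0).1) *
        (m.2 - d * (N * (Δ.vertex 0).2)) * hl'
    have h2 : (L 2 (d, m) : ℚ) = (ε * ((Δ.vertex 2).2 - (Δ.vertex 0).2)) *
        Δ.coord 2 (N * d, m) := by
      rw [hL2, coord_apply, mul_div_assoc', eq_div_iff harea, area]
      push_cast
      rw [hY0', hy]
      ring
    have hpos0 : 0 < (ε : ℚ) * ((Δ.vertex 1).1 - (Δ.vertex 0).1) := by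
      have h3 : (0 : ℚ) < ε * (X1 - X0) := by exact_mod_cast hεbase
      rw [hX0', hX1', ← mul_sub, mul_left_comm] at h3
      exact pos_of_mul_pos_right h3 hN'.le
    have hpos2 : 0 < (ε : ℚ) * ((Δ.vertex 2).2 - (Δ.vertex 0).2) := by
      have h3 : (0 : ℚ) < ε * H := by exact_mod_cast hεH
      rw [hH', mul_left_comm] at h3
      exact pos_of_mul_pos_right h3 hN'.le
    rw [mem_semigroup_iff harea, Fin.forall_fin_succ, Fin.forall_fin_two, Fin.forall_fin_succ,
      Fin.forall_fin_two]
    change 0 ≤ Δ.coord 0 _ ∧ 0 ≤ Δ.coord 1 _ ∧ 0 ≤ Δ.coord 2 _ ↔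
      0 ≤ L 0 _ ∧ 0 ≤ L 1 _ ∧ 0 ≤ L 2 _
    rw [← Int.cast_nonneg_iff (R := ℚ), ← Int.cast_nonneg_iff (R := ℚ) (n := L 1 _),
      ← Int.cast_nonneg_iff (R := ℚ) (n := L 2 _), h0, h1, h2,
      mul_nonneg_iff_of_pos_left (mul_pos (by exact_mod_cast hb) hpos0),
      mul_nonneg_iff_of_pos_left (mul_pos (by exact_mod_cast ha) hpos0),
      mul_nonneg_iff_of_pos_left hpos2]
  · intro d m m' h
    have h2 := h 2
    have h1 := h 1
    simp only [hL1, hL2] at h1 h2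
    have e2 : m.2 = m'.2 := by linear_combination ε * h2 - (m.2 - m'.2) * hε
    refine Prod.ext (mul_left_cancel₀ ha'.ne' ?_) e2
    linear_combination ε * h1 - (a * (m.1 - m'.1) - p * (m.2 - m'.2)) * hε + p * e2
  · intro d n hn
    have hn' : (n 0 * a + n 1 * b + n 2 * (b * p - a * q) : ℤ) = D * d := by
      rw [Fin.sum_univ_three] at hn
      simp only [Matrix.cons_val] at hn
      rw [← hw]
      exact_mod_cast hn
    -- `a * u = R₁` and `b * u = R₀` for `u = m.1 - d * X0` are solved by `u = α * R₁ + β * R₀`.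
    set R₁ : ℤ := ε * (n 1 + p * n 2) with hR₁
    set R₀ : ℤ := ε * (q * n 2 - n 0) + b * d * (X1 - X0) with hR₀
    have hR : a * R₀ = b * R₁ := by
      linear_combination d * hbaseH - ε * hn' + ε * d * hD - d * (b * p - a * q) * H * hε
    have hu₁ : a * (α * R₁ + β * R₀) = R₁ := by linear_combination R₁ * hαβ + β * hR
    have hu₀ : b * (α * R₁ + β * R₀) = R₀ := by linear_combination R₀ * hαβ - α * hR
    refine ⟨(d * X0 + (α * R₁ + β * R₀), d * Y0 + ε * n 2), fun i => ?_⟩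
    fin_cases i
    · change L 0 _ = n 0
      rw [hL0]
      linear_combination -ε * hu₀ + n 0 * hε
    · change L 1 _ = n 1
      rw [hL1]
      linear_combination ε * hu₁ + n 1 * hε
    · change L 2 _ = n 2
      rw [hL2]
      linear_combination n 2 * hε

end RationalTriangle

end ToricTriangle

theorem mainTheorem6 {k : Type u} [Field k] [IsAlgClosed k] [CharZero k]
    (Δ : ToricTriangle.RationalTriangle) (s t : ℚ) (hs : 0 < s) (hst : s < t)
    (h_base : ToricTriangle.HasSlope (Δ.vertex 0) (Δ.vertex 1) 0)
    (h_s : ToricTriangle.HasSlope (Δ.vertex 0) (Δ.vertex 2) s)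
    (h_t : ToricTriangle.HasSlope (Δ.vertex 1) (Δ.vertex 2) t)
    (a p b q : ℕ) (hp : 0 < p) (hq : 0 < q) (hap : Nat.Coprime a p) (hbq : Nat.Coprime b q)
    (hsa : s = (a : ℚ) / (p : ℚ)) (htb : t = (b : ℚ) / (q : ℚ)) :
    ((∃ w : Fin 3 → ℕ, (∀ i, 0 < w i) ∧
        Nonempty (ToricTriangle.toricSurface k Δ ≅ ToricTriangle.weightedProjectivePlane k w)) ↔
      Nat.Coprime a b) ∧
    (Nat.Coprime a b →
      a * q < b * p ∧
      Nonempty (ToricTriangle.toricSurface k Δ ≅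
        ToricTriangle.weightedProjectivePlane k ![a, b, b * p - a * q])) := by
  subst hsa htb
  have hp' : (0 : ℚ) < p := by exact_mod_cast hp
  have hq' : (0 : ℚ) < q := by exact_mod_cast hq
  have ha : 0 < a := by
    rw [div_pos_iff_of_pos_right hp'] at hs
    exact_mod_cast hs
  have hlt : a * q < b * p := by
    rw [div_lt_div_iff₀ hp' hq'] at hst
    exact_mod_cast hst
  have hb : 0 < b := Nat.pos_of_ne_zero fun h => by simp [h] at hlt
  obtain ⟨N, V, hN, hV⟩ := Δ.exists_lattice_multiple
  have E :=
    ToricTriangle.RationalTriangle.edgeEquations_of_hasSlope ha hp hq hN hV h_base h_s h_t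
  have hiso := fun hab =>
    ToricTriangle.RationalTriangle.nonempty_iso_of_coprime (k := k) hN hV E ha hb hlt hab
  refine ⟨⟨?_, fun hab => ⟨![a, b, b * p - a * q], ?_, hiso hab⟩⟩, fun hab => ⟨hlt, hiso hab⟩⟩
  · rintro ⟨w, hw, ⟨e⟩⟩
    by_contra hab
    -- `PowersAreLocal (gcd a b)` holds for the weighted projective plane only.
    have hg := Nat.gcd_pos_of_pos_left b ha
    exact ToricTriangle.RationalTriangle.not_powersAreLocal_toricSurface (E.area_ne_zero hV)
      (lt_of_le_of_ne hg (Ne.symm hab)) hN hV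
      (E.exists_direction hp hq hap hbq (Nat.gcd_dvd_left a b) (Nat.gcd_dvd_right a b))
      ((ToricTriangle.powersAreLocal_weightedProjectivePlane hg hw).of_iso
        ((Over.forget _).mapIso e.symm))
  · have := Nat.sub_pos_of_lt hlt
    intro i
    fin_cases i <;> simpa
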